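/- **Theorem (Attractor tree formula).** Let $r\ge 0$ and $S=\mathbb N^r\setminus\{0\}$. A (rational) *collection* is a map $F:\bigcup_{n\ge1}S^n\to\mathbb Q$; put $\mathbb 1(\alpha)=1$ for $\alpha\in S^1$ and $0$ otherwise. The *plethysm* is $$(F\circ G)(\alpha)=\sum_{\pi}F(\pi_*\alpha)\prod_{j}G(\alpha|_{\pi^{-1}(j)}),\qquad \alpha\in S^n,$$ over order-preserving surjections $\pi:\{1,\dots,n\}\to\{1,\dots,m\}$, $m\ge 1$, with $(\pi_*\alpha)_j=\sum_{i\in\pi^{-1}(j)}\alpha_i$; $F^{-1}$ denotes the two-sided inverse with respect to $\circ$ and $\mathbb 1$. For a $\mathbb Q$-algebra $\mathcal R$ and $H:S\to\mathcal R$ put $(F*H)(\gamma)=\sum_{n\ge 1,\ \alpha\in S^n,\ \alpha_1+\dots+\alpha_n=\gamma}F(\alpha)\,H(\alpha_1)\cdots H(\alpha_n)$. Let $\langle-,-\rangle$ be a skew-symmetric integral bilinear form on $\mathbb Z^r$, let $\mathcal R=\bigoplus_{\gamma\in\mathbb N^r}\mathcal R_\gamma$ be a graded associative $\mathbb Q$-algebra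 such that $\langle\gamma,\gamma'\rangle=0$ implies $[\mathcal R_\gamma,\mathcal R_{\gamma'}]=0$ for $\gamma,\gamma'\in S$, and let $A:S\to\mathcal R$ with $A(\gamma)\in\mathcal R_\gamma$. A *central charge* is $Z=-\theta+\mathbf i\rho$ with $\theta,\rho\in\mathbb R^r$, $\rho_k>0$; it orders $S$ by the slope $\mu_Z(a)=\sum_k\theta_ka_k/\sum_k\rho_ka_k$, i.e. $a\le_Z b$ iff $\mu_Z(a)\le\mu_Z(b)$ and $a\sim_Z b$ iff $\mu_Z(a)=\mu_Z(b)$; $Z$ is *generic* if $a\sim_Z b$ implies $ma=nb$ for some integers $m,n\ge1$. Let $s_Z(\alpha)=1$ if $\alpha_1>_Z\dots>_Z\alpha_n$ and $0$ otherwise; let $\mathbf{log}_Z(\alpha)=(-1)^{n-1}/n$ if $\alpha_1\sim_Z\dots\sim_Z\alpha_n$ and $0$ otherwise. Let $A_Z:S\to\mathcal R$ be the solution of $A=s_Z*A_Z$ (determined recursively), $\bar A_Z=\mathbf{log}_Z*A_Z$, and $g_Z=\mathbf{log}_Z\circ s_Z^{-1}$. For $\gamma\in S$ let $\bar A_*(\gamma)=\bar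 A_{\theta'}(\gamma)$, where $\theta'\in\mathbb R^r$ is a generic perturbation of $\theta=\langle-,\gamma\rangle$ (generic and sufficiently close to $\theta$, depending on $\gamma$; $\theta'$ is used as the central charge with $\rho=(1,\dots,1)$). Let $g_*$ be the collection with $$g_*(\alpha)=\frac{(-1)^{n-1}}{n_0+1}\ \text{ if }\langle\alpha_{\le k},\alpha_{>k}\rangle\ge0\text{ for all }1\le k<n,\qquad g_*(\alpha)=0\ \text{ otherwise},\qquad\alpha\in S^n,$$ where $\alpha_{\le k}=\alpha_1+\dots+\alpha_k$, $\alpha_{>k}=\alpha_{k+1}+\dots+\alpha_n$ and $n_0$ is the number of $1\le k<n$ with $\langle\alpha_{\le k},\alpha_{>k}\rangle=0$. For plane rooted trees $T$ with leaves $1,\dots,n$ and internal vertices having at least two children, let $V(T)$ be the set of internal vertices and, for $v\in V(T)$, let $\alpha|_{\mathrm{ch}\,v}$ be the tuple of the sums $\alpha_u=\sum_i\alpha_i$ over the leaves $i$ below $u$, for the children $u$ of $v$ in order. Put $(\mathbb T F)(\alpha)=\sum_T\prod_{v\in V(T)}F(\alpha|_{\mathrm{ch}\,v})$ for $F$ vanishing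 on $S^1$. Let $F_Z$ be the collection with $F_Z(\alpha)=1$ for $\alpha\in S^1$ and, for $\alpha\in S^n$, $n\ge2$, $$F_Z(\alpha)=\sum_T(-1)^{|V(T)|-1}\bigl(g_Z(\alpha|_{\mathrm{ch}\,v_0})-g_*(\alpha|_{\mathrm{ch}\,v_0})\bigr)\prod_{v\in V(T)\setminus\{v_0\}}g_*(\alpha|_{\mathrm{ch}\,v}),$$ where $v_0$ is the root of $T$. Then $\bar A_*$ is well defined (for each $\gamma$, generic perturbations exist and $\bar A_{\theta'}(\gamma)$ is the same for all generic $\theta'$ sufficiently close to $\langle-,\gamma\rangle$), the inverse $g_*^{-1}$ exists, and for every central charge $Z$ the inverse $s_Z^{-1}$ exists, $$\bar A_Z=F_Z*\bar A_*,\qquad\text{i.e.}\qquad \bar A_Z(\gamma)=\sum_{\alpha_1+\dots+\alpha_n=\gamma}F_Z(\alpha)\,\bar A_*(\alpha_1)\cdots\bar A_*(\alpha_n)\quad(\gamma\in S),$$ and $$F_Z=\mathbb 1+(g_Z-g_*)\circ\mathbb T(\mathbb 1-g_*)=g_Z\circ g_*^{-1}.$$ -/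

import Mathlib

open Filter Topology

namespace AttractorTree

/-! ### The semigroup `S = ℕ^r \ {0}` and tuples in it -/

/-- The commutative semigroup `S = ℕ^r \ {0}`. -/
abbrev S (r : ℕ) : Type := {γ : Fin r → ℕ // γ ≠ 0}

/-- The image of an element of `ℕ^r` in the lattice `Γ = ℤ^r`. -/
def toLattice {r : ℕ} (γ : Fin r → ℕ) : Fin r → ℤ := fun k => (γ k : ℤ)

/-- The degree `δ · γ` with `δ = (1, …, 1)`. -/
def degree {r : ℕ} (γ : S r) : ℕ := ∑ k, γ.1 k

theorem degree_pos {r : ℕ} (γ : S r) : 0 < degree γ := by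
  rcases Function.ne_iff.mp γ.2 with ⟨k, hk⟩
  exact lt_of_lt_of_le (Nat.pos_of_ne_zero hk)
    (Finset.single_le_sum (f := fun k => γ.1 k) (fun _ _ => Nat.zero_le _) (Finset.mem_univ k))

theorem sum_ne_zero {r n : ℕ} (hn : 0 < n) (α : Fin n → S r) :
    (∑ i, (α i).1) ≠ 0 := by
  intro h
  have h1 := (Finset.sum_eq_zero_iff (s := Finset.univ) (f := fun i => (α i).1)).mp h
  exact (α ⟨0, hn⟩).2 (h1 ⟨0, hn⟩ (Finset.mem_univ _))

/-- The sum `‖α‖ = α₁ + ⋯ + αₙ` of a non-empty tuple, as an element of `S`. -/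
def total {r n : ℕ} (hn : 0 < n) (α : Fin n → S r) : S r :=
  ⟨∑ i, (α i).1, sum_ne_zero hn α⟩

theorem degree_total {r n : ℕ} (hn : 0 < n) (α : Fin n → S r) :
    degree (total hn α) = ∑ i, degree (α i) := by
  simp only [degree, total, Finset.sum_apply]
  exact Finset.sum_comm

/-- All expressions `γ = α₁ + ⋯ + αₙ` with `n ≥ 1` and `αᵢ ∈ S` (ordered). -/
abbrev Decomp {r : ℕ} (γ : S r) : Type :=
  {α : (Σ n : ℕ+, (Fin n → S r)) // total α.1.pos α.2 = γ}

theorem le_degree_of_total {r n : ℕ} (hn : 0 < n) (α : Fin n → S r) :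
    n ≤ degree (total hn α) := by
  rw [degree_total]
  calc n = ∑ _i : Fin n, 1 := by simp
    _ ≤ _ := Finset.sum_le_sum fun i _ => degree_pos (α i)

instance finite_decomp {r : ℕ} (γ : S r) : Finite (Decomp γ) := by
  have hle : ∀ (α : Decomp γ) (i : Fin α.1.1), (α.1.2 i).1 ≤ γ.1 := by
    intro α i
    have h : γ.1 = ∑ i, (α.1.2 i).1 := (congrArg Subtype.val α.2).symm
    rw [h]
    exact Finset.single_le_sum (f := fun i => (α.1.2 i).1) (fun _ _ => zero_le)
      (Finset.mem_univ i)
  have hn : ∀ α : Decomp γ, (α.1.1 : ℕ) ≤ degree γ := by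
    intro α
    have h := le_degree_of_total α.1.1.pos α.1.2
    rwa [α.2] at h
  let f : Decomp γ →
      Σ n : Fin (degree γ + 1), (Fin n → {x : Fin r → ℕ // x ∈ Finset.Iic γ.1}) :=
    fun α => ⟨⟨α.1.1, Nat.lt_succ_of_le (hn α)⟩,
      fun i => ⟨(α.1.2 i).1, Finset.mem_Iic.mpr (hle α i)⟩⟩
  refine Finite.of_injective f ?_
  rintro ⟨⟨⟨n, hn⟩, α⟩, hα⟩ ⟨⟨⟨m, hm⟩, β⟩, hβ⟩ h
  simp only [f, Sigma.mk.injEq, Fin.mk.injEq] at h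
  obtain ⟨h1, h2⟩ := h
  change n = m at h1
  subst h1
  have h3 := eq_of_heq h2
  have : α = β := by
    funext i
    have h4 := congrFun h3 i
    simp only [Subtype.mk.injEq] at h4
    exact Subtype.ext h4
  subst this
  rfl

noncomputable instance fintypeDecomp {r : ℕ} (γ : S r) : Fintype (Decomp γ) :=
  Fintype.ofFinite _

theorem degree_part_lt {r : ℕ} {γ : S r} (α : Decomp γ) (h : 2 ≤ (α.1.1 : ℕ)) (i : Fin α.1.1) :
    degree (α.1.2 i) < degree γ := by
  obtain ⟨⟨n, α⟩, hα⟩ := α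
  dsimp only at *
  rw [← hα, degree_total]
  have : Nontrivial (Fin n) := Fin.nontrivial_iff_two_le.mpr h
  obtain ⟨j, hj⟩ := exists_ne i
  exact Finset.single_lt_sum (f := fun i => degree (α i)) hj (Finset.mem_univ i) (Finset.mem_univ j) (degree_pos (α j))
    (fun _ _ _ => Nat.zero_le _)

/-! ### Collections, plethysm and the action on 1-collections -/

/-- Collections with rational values: maps `S^* = ⋃_{n ≥ 1} S^n → ℚ`. -/
abbrev Col (r : ℕ) : Type := (n : ℕ+) → (Fin n → S r) → ℚ

/-- The identity collection `𝟙`. -/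
def idCol (r : ℕ) : Col r := fun n _ => if (n : ℕ) = 1 then 1 else 0

/-- The tuple `π_* α`, where `π` is the order-preserving surjection that collapses the blocks of
the composition `c`. -/
def blockSum {r n : ℕ} (c : Composition n) (α : Fin n → S r) : Fin c.length → S r :=
  fun j => total (c.one_le_blocksFun j) (fun i => α (c.embedding j i))

/-- Plethysm `F ∘ G`. Order-preserving surjections `π : {1, …, n} → J` are the compositions
of `n`, the fibres of `π` being the blocks. -/
def pleth {r : ℕ} (F G : Col r) : Col r := fun n α =>
  ∑ c : Composition n,
    F ⟨c.length, c.length_pos_of_pos n.pos⟩ (blockSum c α) *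
      ∏ j : Fin c.length, G ⟨c.blocksFun j, c.one_le_blocksFun j⟩ (fun i => α (c.embedding j i))

/-- `G` is a two-sided inverse of `F` with respect to plethysm. -/
def IsPlethInv {r : ℕ} (F G : Col r) : Prop := pleth F G = idCol r ∧ pleth G F = idCol r

open Classical in
/-- The inverse `F⁻¹` of `F` with respect to plethysm (zero if `F` has no inverse). -/
noncomputable def plethInv {r : ℕ} (F : Col r) : Col r :=
  if h : ∃ G, IsPlethInv F G then h.choose else 0

/-- The action `F * H` of a collection on a 1-collection with values in a `ℚ`-algebra:
`(F * H)(γ) = ∑_{α₁ + ⋯ + αₙ = γ} F(α) H(α₁) ⋯ H(αₙ)`, an ordered product. -/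
noncomputable def act {r : ℕ} {R : Type*} [Ring R] [Algebra ℚ R] (F : Col r) (H : S r → R) :
    S r → R := fun γ =>
  ∑ α : Decomp γ, F α.1.1 α.1.2 • (List.ofFn fun i => H (α.1.2 i)).prod

/-! ### Plane trees -/

/-- Plane rooted trees with `n` leaves, numbered `1, …, n` from left to right, all of whose
internal vertices have at least two children. A tree is the unit tree (one leaf, no internal
vertex), or it has a root with an ordered list of at least two subtrees; the numbers of leaves of
the subtrees form a composition of `n`, and the `j`-th subtree has the `j`-th block as its set of
leaves. -/
inductive PlaneTree : ℕ → Type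
  | leaf : PlaneTree 1
  | node {n : ℕ} (c : Composition n) (hc : 2 ≤ c.length)
      (children : (j : Fin c.length) → PlaneTree (c.blocksFun j)) : PlaneTree n

theorem blocksFun_lt {n : ℕ} (c : Composition n) (hc : 2 ≤ c.length) (j : Fin c.length) :
    c.blocksFun j < n := by
  have : Nontrivial (Fin c.length) := Fin.nontrivial_iff_two_le.mpr hc
  obtain ⟨k, hk⟩ := exists_ne j
  calc c.blocksFun j < ∑ i, c.blocksFun i :=
        Finset.single_lt_sum hk (Finset.mem_univ j) (Finset.mem_univ k) (c.one_le_blocksFun k)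
          (fun _ _ _ => Nat.zero_le _)
    _ = n := c.sum_blocksFun

instance finite_planeTree (n : ℕ) : Finite (PlaneTree n) := by
  induction n using Nat.strong_induction_on with
  | _ n ih =>
    have : ∀ c : {c : Composition n // 2 ≤ c.length},
        Finite ((j : Fin c.1.length) → PlaneTree (c.1.blocksFun j)) := by
      intro c
      have := fun j => ih _ (blocksFun_lt c.1 c.2 j)
      infer_instance
    let f : PlaneTree n → Option (Σ c : {c : Composition n // 2 ≤ c.length},
        ((j : Fin c.1.length) → PlaneTree (c.1.blocksFun j))) := fun T =>
      match T with
      | .leaf => none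
      | .node c hc ch => some ⟨⟨c, hc⟩, ch⟩
    refine Finite.of_injective f ?_
    intro T T' h
    cases T with
    | leaf =>
      cases T' with
      | leaf => rfl
      | node c hc ch => simp [f] at h
    | node c hc ch =>
      cases T' with
      | leaf => simp [f] at h
      | node c' hc' ch' =>
        simp only [f, Option.some.injEq, Sigma.mk.injEq, Subtype.mk.injEq] at h
        obtain ⟨h1, h2⟩ := h
        subst h1
        rw [eq_of_heq h2]

noncomputable instance fintypePlaneTree (n : ℕ) : Fintype (PlaneTree n) := Fintype.ofFinite _

/-- The number `|V(T)|` of internal vertices. -/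
def PlaneTree.numVertices : {n : ℕ} → PlaneTree n → ℕ
  | _, .leaf => 0
  | _, .node _ _ ch => 1 + ∑ j, (ch j).numVertices

/-- `F(T)(α) = ∏_{v ∈ V(T)} F(α|_{ch v})`, where `α|_{ch v} = (α_u)_{u ∈ ch v}` and `α_u` is the
sum of the `αᵢ` over the leaves `i` below `u`. -/
def PlaneTree.vertexProd {r : ℕ} (F : Col r) : {n : ℕ} → PlaneTree n → (Fin n → S r) → ℚ
  | _, .leaf, _ => 1
  | _, .node c hc ch, α =>
      F ⟨c.length, lt_of_lt_of_le Nat.zero_lt_two hc⟩ (blockSum c α) *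
        ∏ j, (ch j).vertexProd F (fun i => α (c.embedding j i))

/-- For a tree `T` with root `v₀`, the product
`F₀(α|_{ch v₀}) ∏_{v ∈ V(T) \ {v₀}} F(α|_{ch v})` (zero for the unit tree, which has no root). -/
def PlaneTree.rootedProd {r : ℕ} (F₀ F : Col r) : {n : ℕ} → PlaneTree n → (Fin n → S r) → ℚ
  | _, .leaf, _ => 0
  | _, .node c hc ch, α =>
      F₀ ⟨c.length, lt_of_lt_of_le Nat.zero_lt_two hc⟩ (blockSum c α) *
        ∏ j, (ch j).vertexProd F (fun i => α (c.embedding j i))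

/-- The free construction `𝕋 F` (for `F` vanishing on `S = S^1`, so that only trees whose internal
vertices have at least two children contribute). -/
noncomputable def freeCol {r : ℕ} (F : Col r) : Col r := fun n α =>
  ∑ T : PlaneTree n, T.vertexProd F α

/-! ### Central charges and DT invariants -/

/-- A central charge `Z = -θ + iρ` on `ℤ^r` with `ρ_k > 0` for all `k`. -/
structure CentralCharge (r : ℕ) where
  θ : Fin r → ℝ
  ρ : Fin r → ℝ
  ρ_pos : ∀ k, 0 < ρ k

namespace CentralCharge

variable {r : ℕ}

/-- The slope `μ_Z(a) = (∑ θ_k a_k) / (∑ ρ_k a_k)`. The stability is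
`a ≤_Z b ↔ μ_Z(a) ≤ μ_Z(b)`, equivalently `Arg Z(a) ≤ Arg Z(b)`. -/
noncomputable def slope (Z : CentralCharge r) (a : S r) : ℝ :=
  (∑ k, Z.θ k * (a.1 k : ℝ)) / (∑ k, Z.ρ k * (a.1 k : ℝ))

/-- The central charge with parameter `θ` and `ρ = (1, …, 1)`, defining the stability `≤_θ`. -/
def ofTheta (θ : Fin r → ℝ) : CentralCharge r := ⟨θ, fun _ => 1, fun _ => one_pos⟩

/-- The stability is generic: `a ∼_Z b` implies that `a` and `b` are proportional. -/
def IsGeneric (Z : CentralCharge r) : Prop :=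
  ∀ a b : S r, Z.slope a = Z.slope b → ∃ m n : ℕ, 1 ≤ m ∧ 1 ≤ n ∧ m • a.1 = n • b.1

open Classical in
/-- The Harder-Narasimhan collection `s_Z`: `1` if `α₁ >_Z ⋯ >_Z αₙ`, and `0` otherwise. -/
noncomputable def hn (Z : CentralCharge r) : Col r := fun _ α =>
  if ∀ i j, i < j → Z.slope (α j) < Z.slope (α i) then 1 else 0

open Classical in
/-- The collection `log_Z`: `(-1)^(n-1) / n` if `α₁ ∼_Z ⋯ ∼_Z αₙ`, and `0` otherwise. -/
noncomputable def log (Z : CentralCharge r) : Col r := fun n α =>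
  if ∀ i j, Z.slope (α i) = Z.slope (α j) then (-1) ^ ((n : ℕ) - 1) / ((n : ℕ) : ℚ) else 0

/-- The collection `g_Z = log_Z ∘ s_Z⁻¹`. -/
noncomputable def g (Z : CentralCharge r) : Col r := pleth Z.log (plethInv Z.hn)

/-- The stacky DT invariants `A_Z`, given by the recursion
`A(γ) = ∑_{α₁ + ⋯ + αₙ = γ, α₁ >_Z ⋯ >_Z αₙ} A_Z(α₁) ⋯ A_Z(αₙ)`, solved for the summand
`A_Z(γ)` with `n = 1`. -/
noncomputable def stackyDT {R : Type*} [Ring R] [Algebra ℚ R] (Z : CentralCharge r)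
    (A : S r → R) (γ : S r) : R :=
  A γ - ∑ α : {α : Decomp γ // 2 ≤ (α.1.1 : ℕ)},
    Z.hn α.1.1.1 α.1.1.2 • (List.ofFn fun i => Z.stackyDT A (α.1.1.2 i)).prod
termination_by degree γ
decreasing_by exact degree_part_lt α.1 α.2 i

/-- The basic wall-crossing formula `A = s_Z * A_Z` holds for `A_Z` as defined. -/
theorem eq_act_hn_stackyDT {R : Type*} [Ring R] [Algebra ℚ R] (Z : CentralCharge r)
    (A : S r → R) : A = act Z.hn (Z.stackyDT A) := by
  classical
  funext γ
  have h := CentralCharge.stackyDT.eq_1 Z A γ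
  unfold act
  rw [← Finset.sum_filter_add_sum_filter_not Finset.univ (fun α : Decomp γ => 2 ≤ (α.1.1 : ℕ))]
  rw [eq_sub_iff_add_eq] at h
  rw [← h, add_comm]
  congr 1
  · symm
    apply Finset.sum_subtype
    simp
  · let a0 : Decomp γ := ⟨⟨1, fun _ => γ⟩, by
      apply Subtype.ext; exact Fin.sum_univ_one (fun _ => γ.1)⟩
    have : Finset.univ.filter (fun α : Decomp γ => ¬ 2 ≤ (α.1.1 : ℕ)) = {a0} := by
      ext α
      simp only [Finset.mem_filter, Finset.mem_univ, true_and, Finset.mem_singleton]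
      constructor
      · intro h2
        obtain ⟨⟨n, α⟩, hα⟩ := α
        obtain rfl : n = 1 := PNat.eq (by
          have h3 : ¬ 2 ≤ (n : ℕ) := h2
          have h4 := n.pos
          change (n : ℕ) = 1
          omega)
        have : α = fun _ => γ := by
          funext i
          rw [← hα]
          apply Subtype.ext
          have : i = 0 := Subsingleton.elim (α := Fin 1) _ _
          subst this
          exact (Fin.sum_univ_one (fun i => (α i).1)).symm
        subst this
        rfl
      · rintro rfl
        exact (by decide : ¬ 2 ≤ ((1 : ℕ+) : ℕ))
    rw [this, Finset.sum_singleton]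
    have : Z.hn 1 (fun _ => γ) = 1 := by
      unfold hn; simp
    simp only [a0, this, one_smul]
    symm
    have h5 : (List.ofFn (fun _ : Fin 1 => Z.stackyDT A γ)).prod = Z.stackyDT A γ := by simp
    exact h5

/-- The rational DT invariants `Ā_Z = log_Z * A_Z`. -/
noncomputable def rationalDT {R : Type*} [Ring R] [Algebra ℚ R] (Z : CentralCharge r)
    (A : S r → R) : S r → R := act Z.log (Z.stackyDT A)

end CentralCharge

/-! ### Attractor invariants and the attractor tree collection -/

/-- The self-stability `θ = ⟨-, γ⟩`, as an element of `Hom(ℤ^r, ℝ) = ℝ^r`. -/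
def selfStability {r : ℕ} (B : LinearMap.BilinForm ℤ (Fin r → ℤ)) (γ : S r) : Fin r → ℝ :=
  fun k => (B (Pi.single k 1) (toLattice γ.1) : ℝ)

/-- The generic perturbations of `⟨-, γ⟩`: the filter of neighbourhoods of `⟨-, γ⟩` within the
set of generic stability parameters. -/
def genericPerturbations {r : ℕ} (B : LinearMap.BilinForm ℤ (Fin r → ℤ)) (γ : S r) :
    Filter (Fin r → ℝ) :=
  𝓝[{θ' | (CentralCharge.ofTheta θ').IsGeneric}] (selfStability B γ)

open Classical in
/-- The attractor invariant `Ā_*(γ)`: the common value of `Ā_{θ'}(γ)` for all generic `θ'`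
sufficiently close to `⟨-, γ⟩`. -/
noncomputable def attractorDT {r : ℕ} {R : Type*} [Ring R] [Algebra ℚ R]
    (B : LinearMap.BilinForm ℤ (Fin r → ℤ)) (A : S r → R) (γ : S r) : R :=
  if h : ∃ x : R, ∀ᶠ θ' in genericPerturbations B γ,
      (CentralCharge.ofTheta θ').rationalDT A γ = x
  then h.choose else 0

/-- The number `⟨α_{≤ k}, α_{> k}⟩`. -/
def cutPairing {r n : ℕ} (B : LinearMap.BilinForm ℤ (Fin r → ℤ)) (α : Fin n → S r) (k : ℕ) : ℤ :=
  B (toLattice (∑ i : Fin n with i.val < k, (α i).1)) (toLattice (∑ i : Fin n with k ≤ i.val, (α i).1))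

/-- The attractor collection `g_*`. -/
def attractorCol {r : ℕ} (B : LinearMap.BilinForm ℤ (Fin r → ℤ)) : Col r := fun n α =>
  if ∀ k ∈ Finset.Ico 1 (n : ℕ), 0 ≤ cutPairing B α k then
    (-1) ^ ((n : ℕ) - 1) /
      ((((Finset.Ico 1 (n : ℕ)).filter fun k => cutPairing B α k = 0).card : ℚ) + 1)
  else 0

/-- The attractor tree collection `F_Z`: it is `1` on `S`, and on `S^n` with `n ≥ 2` it is
`∑_T (-1)^(|V(T)| - 1) (g_Z(α|_{ch v₀}) - g_*(α|_{ch v₀})) ∏_{v ≠ v₀} g_*(α|_{ch v})`. -/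
noncomputable def treeCol {r : ℕ} (B : LinearMap.BilinForm ℤ (Fin r → ℤ)) (Z : CentralCharge r) :
    Col r := fun n α =>
  if (n : ℕ) = 1 then 1
  else ∑ T : PlaneTree n,
    (-1) ^ (T.numVertices - 1) * T.rootedProd (Z.g - attractorCol B) (attractorCol B) α

end AttractorTree

open AttractorTree

namespace AttractorTree

variable {r : ℕ}

/-! ### Splitting tuples along compositions -/

/-! Plethysm makes collections a monoid acting on 1-collections (`act_pleth`, `act_idCol`). So it
suffices to express both kinds of invariants through the same `A`: if Ā_Z = g_Z * A and Ā_* = g_* *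
A, then Ā_Z = (g_Z ∘ g_*⁻¹) * Ā_*.

Inverses come from trees. Splitting a tree at its root gives 𝕋F = 𝟙 + F ∘ 𝕋F (`freeCol_eq`), so 𝕋(𝟙
- F) inverts every F that is 1 on S^1. Expanding signs vertex by vertex identifies the tree sum F_Z
with 𝟙 + (g_Z - g_*) ∘ g_*⁻¹ = g_Z ∘ g_*⁻¹.

The collection g_Z has an explicit form `cutCol` of the same shape as g_*: the pairing at a cut is
replaced by a quantity comparing the slope of α_{≤k} with that of the total. This amounts to
`cutCol` ∘ s_Z = log_Z (`pleth_cutCol_hn`), an alternating sum over cut sets (`sum_cutWeight`).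

For θ' near ⟨-,γ⟩ the nonzero pairings keep their signs, so g_θ' and g_* can only differ on tuples
with a cut of zero pairing. Rotating a tuple at such a cut swaps two commuting factors and preserves
the product of the `A`'s. Over these rotations the weights of g_θ' and of g_* have the same sum, by
a cycle lemma (`sum_cyclic`). Hence both act alike in degree γ (`act_cutCol_eq_act_attractorCol`).
Density of generic parameters makes the value Ā_*(γ) unique. -/

theorem splitWrtComposition_ofFn {X : Type*} {n : ℕ} (c : Composition n) (x : Fin n → X) :
    (List.ofFn x).splitWrtComposition c =
      List.ofFn fun j => List.ofFn fun i => x (c.embedding j i) := by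
  apply List.ext_getElem
  · simp
  intro j h1 h2
  have hj : j < c.length := by simpa using h2
  rw [List.getElem_splitWrtComposition]
  simp only [List.getElem_ofFn]
  have hsucc := c.sizeUpTo_succ hj
  have hle := c.sizeUpTo_le (j + 1)
  apply List.ext_getElem
  · simp only [List.length_drop, List.length_take, List.length_ofFn, Composition.blocksFun,
      List.get_eq_getElem]
    omega
  · intro i h3 h4
    simp only [List.getElem_drop, List.getElem_take, List.getElem_ofFn]
    congr 1

theorem ofFn_eq_flatten {X : Type*} {n : ℕ} (c : Composition n) (x : Fin n → X) :
    (List.ofFn fun j => List.ofFn fun i => x (c.embedding j i)).flatten = List.ofFn x := by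
  rw [← splitWrtComposition_ofFn]
  exact List.flatten_splitWrtCompositionAux (by simp [c.blocks_sum])

theorem sum_embedding {M : Type*} [AddCommMonoid M] {n : ℕ} (c : Composition n) (x : Fin n → M) :
    ∑ j, ∑ i, x (c.embedding j i) = ∑ i, x i := by
  rw [← c.blocksFinEquiv.sum_comp, Fintype.sum_sigma]
  rfl

theorem total_blockSum {r n : ℕ} (c : Composition n) (hn : 0 < n) (α : Fin n → S r) :
    total (c.length_pos_of_pos hn) (blockSum c α) = total hn α := by
  apply Subtype.ext
  exact sum_embedding c fun i => (α i).1

/-! ### The action of collections is a monoid action -/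

section Action

variable {R : Type*} [Ring R] [Algebra ℚ R]

/-- A decomposition of `γ` with a composition of its index set, as a two-step decomposition. -/
def splitDecomp {γ : S r} (p : Σ α : Decomp γ, Composition α.1.1) :
    Σ β : Decomp γ, ∀ j : Fin β.1.1, Decomp (β.1.2 j) :=
  ⟨⟨⟨⟨p.2.length, p.2.length_pos_of_pos p.1.1.1.pos⟩, blockSum p.2 p.1.1.2⟩,
      (total_blockSum p.2 p.1.1.1.pos p.1.1.2).trans p.1.2⟩,
    fun j => ⟨⟨⟨p.2.blocksFun j, p.2.one_le_blocksFun j⟩,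
      fun i => p.1.1.2 (p.2.embedding j i)⟩, rfl⟩⟩

/-- The list of lists underlying a two-step decomposition. -/
def nestedList {γ : S r} (q : Σ β : Decomp γ, ∀ j : Fin β.1.1, Decomp (β.1.2 j)) :
    List (List (S r)) :=
  List.ofFn fun j => List.ofFn (q.2 j).1.2

/-- Comparing lists avoids equalities between tuples of different lengths. -/
theorem decomp_ext {γ : S r} {a b : Decomp γ} (h : List.ofFn a.1.2 = List.ofFn b.1.2) : a = b := by
  obtain ⟨⟨⟨n, hn⟩, α⟩, hα⟩ := a
  obtain ⟨⟨⟨m, hm⟩, β⟩, hβ⟩ := b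
  have h1 : n = m := (List.length_ofFn (f := α)).symm.trans
    ((congrArg List.length h).trans (List.length_ofFn (f := β)))
  subst h1
  have h2 : α = β := List.ofFn_injective h
  subst h2
  rfl

/-- The outer parts are not recorded in the list, but each is the total of its inner list. -/
theorem nestedList_injective {γ : S r} : Function.Injective (nestedList (γ := γ)) := by
  rintro ⟨⟨⟨⟨n, hn⟩, α⟩, hα⟩, a⟩ ⟨⟨⟨⟨m, hm⟩, β⟩, hβ⟩, b⟩ h
  have h1 : n = m := by simpa [nestedList] using congrArg List.length h
  subst h1
  have h2 := List.ofFn_injective h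
  have h3 : ∀ j, (a j).1 = (b j).1 := by
    intro j
    have h4 : List.ofFn (a j).1.2 = List.ofFn (b j).1.2 := congrFun h2 j
    generalize (a j).1 = x at h4 ⊢
    generalize (b j).1 = y at h4 ⊢
    obtain ⟨⟨k, hk⟩, x⟩ := x
    obtain ⟨⟨l, hl⟩, y⟩ := y
    have h5 : k = l := (List.length_ofFn (f := x)).symm.trans
      ((congrArg List.length h4).trans (List.length_ofFn (f := y)))
    subst h5
    have h6 : x = y := List.ofFn_injective h4
    rw [h6]
  have h4 : α = β := by
    funext j
    have ha := (a j).2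
    have hb := (b j).2
    rw [h3 j, hb] at ha
    exact ha.symm
  subst h4
  have h5 : a = b := by
    funext j
    exact Subtype.ext (h3 j)
  subst h5
  rfl

theorem nestedList_splitDecomp {γ : S r} (p : Σ α : Decomp γ, Composition α.1.1) :
    nestedList (splitDecomp p) = (List.ofFn p.1.1.2).splitWrtComposition p.2 :=
  (splitWrtComposition_ofFn p.2 p.1.1.2).symm

/-- Flattening recovers the tuple, and the lengths of the inner lists recover the composition. -/
theorem splitDecomp_injective {γ : S r} : Function.Injective (splitDecomp (γ := γ)) := by
  intro p q h
  have h1 := congrArg nestedList h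
  have h2 : List.ofFn p.1.1.2 = List.ofFn q.1.1.2 := by
    exact (ofFn_eq_flatten p.2 p.1.1.2).symm.trans
      ((congrArg List.flatten h1).trans (ofFn_eq_flatten q.2 q.1.1.2))
  obtain ⟨a, c⟩ := p
  obtain ⟨b, d⟩ := q
  obtain rfl : a = b := decomp_ext h2
  have h3 : c.blocks = d.blocks := by
    have := congrArg (List.map List.length) h1
    simp only [nestedList, splitDecomp, List.map_ofFn, Function.comp_def, List.length_ofFn] at this
    rw [← c.ofFn_blocksFun, ← d.ofFn_blocksFun]
    exact this
  rw [Composition.ext h3]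

theorem splitDecomp_surjective {γ : S r} : Function.Surjective (splitDecomp (γ := γ)) := by
  intro q
  set L := nestedList q with hL
  have hpos : ∀ {l}, l ∈ L → 0 < l.length := by
    intro l hl
    simp only [hL, nestedList, List.mem_ofFn] at hl
    obtain ⟨j, rfl⟩ := hl
    simp
  let c : Composition L.flatten.length :=
    ⟨L.map List.length, by
      intro i hi
      obtain ⟨l, hl, rfl⟩ := List.mem_map.mp hi
      exact hpos hl, by simp [List.length_flatten]⟩
  have hc : 0 < c.length := by
    change 0 < (L.map List.length).length
    simp [hL, nestedList]
  have hn : 0 < L.flatten.length := lt_of_lt_of_le hc c.length_le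
  have htot : total hn L.flatten.get = γ := by
    apply Subtype.ext
    change ∑ i, (L.flatten.get i).1 = γ.1
    have e1 : ∑ i, (L.flatten.get i).1 = (L.flatten.map Subtype.val).sum := by
      rw [← List.sum_ofFn]
      congr 1
      conv_rhs => rw [← List.ofFn_get L.flatten, List.map_ofFn]
      rfl
    rw [e1, List.map_flatten, List.sum_flatten, List.map_map, hL, nestedList, List.map_ofFn,
      List.sum_ofFn]
    have e2 : γ.1 = ∑ j, (q.1.1.2 j).1 := (congrArg Subtype.val q.1.2).symm
    rw [e2]
    refine Finset.sum_congr rfl fun j _ => ?_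
    have e3 : (q.1.1.2 j).1 = ∑ i, ((q.2 j).1.2 i).1 := (congrArg Subtype.val (q.2 j).2).symm
    rw [e3]
    simp [List.map_ofFn, List.sum_ofFn]
  refine ⟨⟨⟨⟨⟨L.flatten.length, hn⟩, L.flatten.get⟩, htot⟩, c⟩, ?_⟩
  apply nestedList_injective
  rw [nestedList_splitDecomp, ← hL]
  change (List.ofFn L.flatten.get).splitWrtComposition c = L
  rw [List.ofFn_get]
  exact List.splitWrtComposition_flatten L c rfl

/-- An ordered product is multilinear in its factors, so sums and scalars come out even in a
noncommutative ring. -/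
theorem prod_ofFn_act (G : Col r) (H : S r → R) {n : ℕ} (β : Fin n → S r) :
    (List.ofFn fun j => act G H (β j)).prod =
      ∑ a : ∀ j, Decomp (β j), (∏ j, G (a j).1.1 (a j).1.2) •
        (List.ofFn fun j => (List.ofFn fun i => H ((a j).1.2 i)).prod).prod := by
  classical
  rw [← MultilinearMap.mkPiAlgebraFin_apply (R := ℚ)]
  unfold act
  rw [MultilinearMap.map_sum]
  refine Finset.sum_congr rfl fun a _ => ?_
  rw [MultilinearMap.map_smul_univ, MultilinearMap.mkPiAlgebraFin_apply]

/-- Both sides expand into sums over two-step decompositions, matched by `splitDecomp`; the ordered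
products agree by associativity. -/
theorem act_pleth (F G : Col r) (H : S r → R) : act (pleth F G) H = act F (act G H) := by
  funext γ
  have h1 : act F (act G H) γ = ∑ q : (Σ β : Decomp γ, ∀ j : Fin β.1.1, Decomp (β.1.2 j)),
      (F q.1.1.1 q.1.1.2 * ∏ j, G (q.2 j).1.1 (q.2 j).1.2) •
        (List.ofFn fun j => (List.ofFn fun i => H ((q.2 j).1.2 i)).prod).prod := by
    rw [Fintype.sum_sigma]
    refine Finset.sum_congr rfl fun β _ => ?_
    rw [prod_ofFn_act, Finset.smul_sum]
    simp only [smul_smul]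
  have h2 : act (pleth F G) H γ = ∑ p : (Σ α : Decomp γ, Composition α.1.1),
      (F ⟨p.2.length, p.2.length_pos_of_pos p.1.1.1.pos⟩ (blockSum p.2 p.1.1.2) *
        ∏ j, G ⟨p.2.blocksFun j, p.2.one_le_blocksFun j⟩ (fun i => p.1.1.2 (p.2.embedding j i))) •
        (List.ofFn fun i => H (p.1.1.2 i)).prod := by
    rw [Fintype.sum_sigma]
    refine Finset.sum_congr rfl fun α _ => ?_
    rw [pleth, Finset.sum_smul]
  rw [h1, h2]
  refine Fintype.sum_bijective splitDecomp ⟨splitDecomp_injective, splitDecomp_surjective⟩ _ _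
    fun p => ?_
  rw [← ofFn_eq_flatten p.2 fun i => H (p.1.1.2 i), List.prod_flatten, List.map_ofFn]
  rfl

theorem act_idCol (H : S r → R) : act (idCol r) H = H := by
  funext γ
  let a₀ : Decomp γ := ⟨⟨1, fun _ => γ⟩, Subtype.ext (Fin.sum_univ_one fun _ => γ.1)⟩
  unfold act
  rw [Finset.sum_eq_single a₀]
  · have h : (List.ofFn fun _ : Fin 1 => H γ).prod = H γ := by simp
    have h1 : idCol r 1 (fun _ => γ) = 1 := rfl
    change idCol r 1 (fun _ => γ) • (List.ofFn fun _ : Fin 1 => H γ).prod = H γ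
    rw [h, h1, one_smul]
  · intro a _ ha
    have : (a.1.1 : ℕ) ≠ 1 := by
      intro h
      apply ha
      obtain ⟨⟨⟨n, hn⟩, α⟩, hα⟩ := a
      change n = 1 at h
      subst h
      apply decomp_ext
      have h1 : α = fun _ => γ := by
        funext i
        rw [← hα]
        have hi : i = (0 : Fin 1) := Subsingleton.elim (α := Fin 1) _ _
        subst hi
        exact Subtype.ext (Fin.sum_univ_one fun i : Fin 1 => (α i).1).symm
      exact congrArg List.ofFn h1
    simp [idCol, this]
  · simp

end Action

/-! ### Plethysm is a monoid structure -/

/-- The universal 1-collection with values in the monoid algebra of words in `S`. -/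
noncomputable def wordCol (r : ℕ) (γ : S r) : MonoidAlgebra ℚ (FreeMonoid (S r)) :=
  MonoidAlgebra.of ℚ _ (FreeMonoid.of γ)

theorem prod_wordCol {r n : ℕ} (α : Fin n → S r) :
    (List.ofFn fun i => wordCol r (α i)).prod =
      MonoidAlgebra.single (FreeMonoid.ofList (List.ofFn α)) 1 := by
  have h : (List.ofFn fun i => wordCol r (α i)) =
      ((List.ofFn α).map FreeMonoid.of).map (MonoidAlgebra.of ℚ _) := by
    rw [List.map_map, List.map_ofFn]
    rfl
  rw [h, ← map_list_prod, MonoidAlgebra.of_apply]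
  congr 1
  generalize List.ofFn α = l
  induction l with
  | nil => rfl
  | cons a l ih => rw [List.map_cons, List.prod_cons, ih]; rfl

theorem act_wordCol_apply {r : ℕ} (F : Col r) {n : ℕ+} (α : Fin n → S r) :
    (act F (wordCol r) (total n.pos α)).coeff (FreeMonoid.ofList (List.ofFn α)) = F n α := by
  let a₀ : Decomp (total n.pos α) := ⟨⟨n, α⟩, rfl⟩
  unfold act
  rw [MonoidAlgebra.coeff_sum, Finsupp.finsetSum_apply, Finset.sum_eq_single a₀]
  · rw [prod_wordCol]
    simp [a₀]
  · intro a _ ha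
    rw [prod_wordCol]
    have : FreeMonoid.ofList (List.ofFn a.1.2) ≠ FreeMonoid.ofList (List.ofFn α) := by
      intro h
      exact ha (decomp_ext (FreeMonoid.ofList.injective h))
    simp [this]
  · simp

/-- The coefficient of a word is the value of the collection on that tuple, so this action is
faithful. The monoid laws of plethysm can therefore be read off from the action. -/
theorem act_wordCol_injective {r : ℕ} :
    Function.Injective fun F : Col r => act F (wordCol r) := by
  intro F G h
  funext n α
  rw [← act_wordCol_apply F α, ← act_wordCol_apply G α]
  exact congrArg (fun X => (X (total n.pos α)).coeff (FreeMonoid.ofList (List.ofFn α))) h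

theorem pleth_assoc {r : ℕ} (F G K : Col r) : pleth (pleth F G) K = pleth F (pleth G K) := by
  apply act_wordCol_injective
  simp [act_pleth]

theorem idCol_pleth {r : ℕ} (F : Col r) : pleth (idCol r) F = F := by
  apply act_wordCol_injective
  simp only [act_pleth, act_idCol]

theorem pleth_idCol {r : ℕ} (F : Col r) : pleth F (idCol r) = F := by
  apply act_wordCol_injective
  simp only [act_pleth, act_idCol]

theorem sub_pleth {r : ℕ} (F G K : Col r) : pleth (F - G) K = pleth F K - pleth G K := by
  funext n α
  exact (Finset.sum_congr rfl fun c _ => sub_mul _ _ _).trans (Finset.sum_sub_distrib _ _)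

/-! ### Plane trees and inverses -/

/-- A plane tree is a leaf or a root with its subtrees. -/
def planeTreeEquiv (n : ℕ) : PlaneTree n ≃ PLift (n = 1) ⊕
    Σ c : {c : Composition n // 2 ≤ c.length}, ∀ j, PlaneTree (c.1.blocksFun j) where
  toFun T := match T with
    | .leaf => .inl ⟨rfl⟩
    | .node c hc ch => .inr ⟨⟨c, hc⟩, ch⟩
  invFun x := match x with
    | .inl h => h.down ▸ .leaf
    | .inr ⟨c, ch⟩ => .node c.1 c.2 ch
  left_inv T := by cases T <;> rfl
  right_inv x := by
    rcases x with ⟨⟨rfl⟩⟩ | ⟨c, ch⟩ <;> rfl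

theorem sum_planeTree {n : ℕ} (φ : PlaneTree n → ℚ) :
    ∑ T, φ T = (if h : n = 1 then φ (h ▸ .leaf) else 0) +
      ∑ c : {c : Composition n // 2 ≤ c.length}, ∑ ch : ∀ j, PlaneTree (c.1.blocksFun j),
        φ (.node c.1 c.2 ch) := by
  classical
  rw [← (planeTreeEquiv n).symm.sum_comp, Fintype.sum_sum_type, Fintype.sum_sigma]
  congr 1
  split_ifs with h
  · subst h
    have : Unique (PLift (1 = 1)) := ⟨⟨⟨rfl⟩⟩, fun _ => Subsingleton.elim _ _⟩
    exact Fintype.sum_unique _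
  · have : IsEmpty (PLift (n = 1)) := ⟨fun x => h x.down⟩
    simp

theorem sum_composition_eq {n : ℕ} (hn : 0 < n) (φ : Composition n → ℚ)
    (h : ∀ c : Composition n, c.length = 1 → φ c = 0) :
    ∑ c, φ c = ∑ c : {c : Composition n // 2 ≤ c.length}, φ c.1 := by
  rw [← Finset.sum_subtype (Finset.univ.filter fun c : Composition n => 2 ≤ c.length)
    (by simp) φ, Finset.sum_filter]
  refine Finset.sum_congr rfl fun c _ => ?_
  split_ifs with h2
  · rfl
  · have := c.length_pos_of_pos hn
    exact h c (by omega)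

/-- A collection of trees with a distinguished weight at the root. -/
theorem pleth_freeCol (F₀ F : Col r) (h₀ : ∀ (n : ℕ+) α, (n : ℕ) = 1 → F₀ n α = 0) (n : ℕ+)
    (α : Fin n → S r) :
    pleth F₀ (freeCol F) n α = ∑ T : PlaneTree n, T.rootedProd F₀ F α := by
  classical
  rw [sum_planeTree]
  have h1 : (if h : (n : ℕ) = 1 then
      (h ▸ PlaneTree.leaf : PlaneTree n).rootedProd F₀ F α else 0) = 0 := by
    obtain ⟨n, hn⟩ := n
    change (if h : n = 1 then (h ▸ PlaneTree.leaf : PlaneTree n).rootedProd F₀ F α else 0) = 0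
    split_ifs with h
    · subst h
      rfl
    · rfl
  rw [h1, zero_add, pleth, sum_composition_eq n.pos]
  · refine Finset.sum_congr rfl fun c _ => ?_
    simp only [PlaneTree.rootedProd, freeCol]
    rw [Finset.prod_univ_sum, Finset.mul_sum, Fintype.piFinset_univ]
    rfl
  · intro c hc
    exact mul_eq_zero_of_left (h₀ ⟨c.length, c.length_pos_of_pos n.pos⟩ _ hc) _

/-- Split at the root: the unit tree gives 𝟙, every other tree a root weight times a family of
subtrees. Vanishing on S^1 discards one-block compositions, which are not roots of plane trees. -/
theorem freeCol_eq (F : Col r) (hF : ∀ (n : ℕ+) α, (n : ℕ) = 1 → F n α = 0) :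
    freeCol F = idCol r + pleth F (freeCol F) := by
  funext n α
  rw [Pi.add_apply, Pi.add_apply, pleth_freeCol F F hF, sum_planeTree, freeCol, sum_planeTree,
    ← add_assoc]
  congr 1
  obtain ⟨n, hn⟩ := n
  change (if h : n = 1 then (h ▸ PlaneTree.leaf : PlaneTree n).vertexProd F α else 0) =
    (if n = 1 then 1 else 0) +
      (if h : n = 1 then (h ▸ PlaneTree.leaf : PlaneTree n).rootedProd F F α else 0)
  split_ifs with h
  · subst h
    exact (add_zero _).symm
  · simp

theorem freeCol_one (F : Col r) (hF : ∀ (n : ℕ+) α, (n : ℕ) = 1 → F n α = 0) (n : ℕ+) (α : Fin n → S r)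
    (hn : (n : ℕ) = 1) : freeCol F n α = 1 := by
  rw [freeCol_eq F hF, Pi.add_apply, Pi.add_apply, pleth]
  have h1 : idCol r n α = 1 := if_pos hn
  rw [h1, Finset.sum_eq_zero, add_zero]
  intro c _
  refine mul_eq_zero_of_left (hF _ _ ?_) _
  have h1 := c.length_pos_of_pos n.pos
  have h2 := c.length_le
  exact le_antisymm (h2.trans hn.le) h1

/-- With T = 𝕋(𝟙 - F) the recursion reads T = 𝟙 + T - F ∘ T; cancel T. -/
theorem pleth_freeCol_idCol_sub (F : Col r) (hF : ∀ (n : ℕ+) α, (n : ℕ) = 1 → F n α = 1) :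
    pleth F (freeCol (idCol r - F)) = idCol r := by
  have h0 : ∀ (n : ℕ+) (α : Fin n → S r), (n : ℕ) = 1 → (idCol r - F) n α = 0 := by
    intro n α hn
    rw [Pi.sub_apply, Pi.sub_apply, hF n α hn]
    simp [idCol, hn]
  have h1 := freeCol_eq (idCol r - F) h0
  rw [sub_pleth, idCol_pleth] at h1
  have h2 : freeCol (idCol r - F) + pleth F (freeCol (idCol r - F)) =
      freeCol (idCol r - F) + idCol r := by
    nth_rw 1 [h1]
    abel
  exact add_left_cancel h2

theorem isPlethInv_freeCol (F : Col r) (hF : ∀ (n : ℕ+) α, (n : ℕ) = 1 → F n α = 1) :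
    IsPlethInv F (freeCol (idCol r - F)) := by
  have h0 : ∀ (n : ℕ+) (α : Fin n → S r), (n : ℕ) = 1 → (idCol r - F) n α = 0 := by
    intro n α hn
    rw [Pi.sub_apply, Pi.sub_apply, hF n α hn]
    simp [idCol, hn]
  have h1 := pleth_freeCol_idCol_sub F hF
  -- The right inverse of `F` is again 1 on S^1, so it has a right inverse too; by associativity
  -- that one is `F`.
  have h2 := pleth_freeCol_idCol_sub (freeCol (idCol r - F)) (freeCol_one _ h0)
  refine ⟨h1, ?_⟩
  have h3 : F = freeCol (idCol r - freeCol (idCol r - F)) := by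
    have h4 := pleth_assoc F (freeCol (idCol r - F)) (freeCol (idCol r - freeCol (idCol r - F)))
    rwa [h1, h2, idCol_pleth, pleth_idCol, eq_comm] at h4
  rwa [← h3] at h2

theorem isPlethInv_plethInv (F : Col r) (hF : ∀ (n : ℕ+) α, (n : ℕ) = 1 → F n α = 1) :
    IsPlethInv F (plethInv F) := by
  have h : ∃ G, IsPlethInv F G := ⟨_, isPlethInv_freeCol F hF⟩
  rw [plethInv, dif_pos h]
  exact h.choose_spec

theorem IsPlethInv.unique {F G K : Col r} (hG : IsPlethInv F G) (hK : IsPlethInv F K) : G = K := by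
  rw [← pleth_idCol G, ← hK.1, ← pleth_assoc, hG.2, idCol_pleth]

/-- Every internal vertex has at least two children, so 𝟙 vanishes there and each vertex contributes
one sign. -/
theorem vertexProd_idCol_sub (F : Col r) {n : ℕ} (T : PlaneTree n) (α : Fin n → S r) :
    T.vertexProd (idCol r - F) α = (-1) ^ T.numVertices * T.vertexProd F α := by
  induction T with
  | leaf => simp [PlaneTree.vertexProd, PlaneTree.numVertices]
  | node c hc ch ih =>
    have h1 : (idCol r - F) ⟨c.length, lt_of_lt_of_le Nat.zero_lt_two hc⟩ (blockSum c α) =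
        -F ⟨c.length, lt_of_lt_of_le Nat.zero_lt_two hc⟩ (blockSum c α) := by
      have : idCol r ⟨c.length, lt_of_lt_of_le Nat.zero_lt_two hc⟩ (blockSum c α) = 0 :=
        if_neg (show c.length ≠ 1 by omega)
      exact (congrArg (· - F _ _) this).trans (zero_sub _)
    simp only [PlaneTree.vertexProd, PlaneTree.numVertices, ih, h1, Finset.prod_mul_distrib,
      Finset.prod_pow_eq_pow_sum, pow_add]
    ring

/-- The root carries `F₀` and gives no sign, whence the exponent |V(T)| - 1. -/
theorem rootedProd_idCol_sub (F₀ F : Col r) {n : ℕ} (T : PlaneTree n) (α : Fin n → S r) :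
    T.rootedProd F₀ (idCol r - F) α = (-1) ^ (T.numVertices - 1) * T.rootedProd F₀ F α := by
  cases T with
  | leaf => simp [PlaneTree.rootedProd]
  | node c hc ch =>
    simp only [PlaneTree.rootedProd, PlaneTree.numVertices, vertexProd_idCol_sub,
      Finset.prod_mul_distrib, Finset.prod_pow_eq_pow_sum, Nat.add_sub_cancel_left]
    ring

theorem treeCol_eq_add_pleth (B : LinearMap.BilinForm ℤ (Fin r → ℤ)) (Z : CentralCharge r)
    (hZ : ∀ (n : ℕ+) α, (n : ℕ) = 1 → Z.g n α = 1)
    (hB : ∀ (n : ℕ+) α, (n : ℕ) = 1 → attractorCol B n α = 1) :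
    treeCol B Z = idCol r + pleth (Z.g - attractorCol B) (freeCol (idCol r - attractorCol B)) := by
  have h0 : ∀ (n : ℕ+) (α : Fin n → S r), (n : ℕ) = 1 → (Z.g - attractorCol B) n α = 0 := by
    intro n α hn
    rw [Pi.sub_apply, Pi.sub_apply, hZ n α hn, hB n α hn, sub_self]
  funext n α
  rw [Pi.add_apply, Pi.add_apply, pleth_freeCol _ _ h0, treeCol, idCol]
  simp only [rootedProd_idCol_sub]
  split_ifs with h
  -- With one leaf only the unit tree exists, and its rooted product is 0 by definition.
  · rw [left_eq_add]
    refine Finset.sum_eq_zero fun T _ => mul_eq_zero_of_right _ ?_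
    obtain ⟨n, hn⟩ := n
    change n = 1 at h
    cases T with
    | leaf => rfl
    | node c hc ch =>
      have h1 : c.length ≤ n := c.length_le
      omega
  · rw [zero_add]

theorem treeCol_eq_pleth (B : LinearMap.BilinForm ℤ (Fin r → ℤ)) (Z : CentralCharge r)
    (hZ : ∀ (n : ℕ+) α, (n : ℕ) = 1 → Z.g n α = 1)
    (hB : ∀ (n : ℕ+) α, (n : ℕ) = 1 → attractorCol B n α = 1) :
    treeCol B Z = pleth Z.g (plethInv (attractorCol B)) := by
  have h := isPlethInv_freeCol _ hB
  rw [treeCol_eq_add_pleth B Z hZ hB, (isPlethInv_plethInv _ hB).unique h, sub_pleth, h.1]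
  abel

/-! ### Cut sets of compositions -/

theorem sizeUpTo_lt_sizeUpTo {n : ℕ} (c : Composition n) {i j : ℕ} (hij : i < j)
    (hj : j ≤ c.length) : c.sizeUpTo i < c.sizeUpTo j :=
  (c.sizeUpTo_strict_mono (hij.trans_le hj)).trans_le (c.monotone_sizeUpTo hij)

/-- The interior cut points of a composition of `n`, as a subset of `{1, …, n - 1}`. -/
def cuts {n : ℕ} (c : Composition n) : Finset ℕ := (Finset.Ico 1 c.length).image c.sizeUpTo

theorem sizeUpTo_injOn {n : ℕ} (c : Composition n) :
    Set.InjOn c.sizeUpTo (Finset.Ico 1 c.length) := by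
  intro i hi j hj h
  simp only [Finset.coe_Ico, Set.mem_Ico] at hi hj
  rcases lt_trichotomy i j with h1 | h1 | h1
  · have := sizeUpTo_lt_sizeUpTo c h1 hj.2.le
    omega
  · exact h1
  · have := sizeUpTo_lt_sizeUpTo c h1 hi.2.le
    omega

theorem mem_cuts {n : ℕ} {c : Composition n} {k : ℕ} :
    k ∈ cuts c ↔ k ∈ Finset.Ico 1 n ∧ ∃ x ∈ c.boundaries, x.val = k := by
  simp only [cuts, Finset.mem_image, Finset.mem_Ico]
  constructor
  · rintro ⟨j, ⟨h1, h2⟩, rfl⟩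
    have h3 := sizeUpTo_lt_sizeUpTo c (show 0 < j by omega) h2.le
    have h4 := sizeUpTo_lt_sizeUpTo c h2 le_rfl
    rw [c.sizeUpTo_zero] at h3
    rw [c.sizeUpTo_length] at h4
    refine ⟨⟨h3, h4⟩, c.boundary ⟨j, by omega⟩, ?_, rfl⟩
    simp [Composition.boundaries]
  · rintro ⟨⟨h1, h2⟩, x, hx, rfl⟩
    simp only [Composition.boundaries, Finset.mem_map, Finset.mem_univ, true_and] at hx
    obtain ⟨⟨i, hi⟩, rfl⟩ := hx
    have h3 : (c.boundary.toEmbedding ⟨i, hi⟩).val = c.sizeUpTo i := rfl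
    rw [h3] at h1 h2
    refine ⟨i, ⟨?_, ?_⟩, rfl⟩
    · by_contra h
      obtain rfl : i = 0 := by omega
      simp at h1
    · by_contra h
      obtain rfl : i = c.length := by omega
      rw [c.sizeUpTo_length] at h2
      omega

theorem mem_boundaries_iff {n : ℕ} {c : Composition n} {x : Fin (n + 1)} :
    x ∈ c.boundaries ↔ x = 0 ∨ x = Fin.last n ∨ x.val ∈ cuts c := by
  constructor
  · intro hx
    by_cases h0 : x = 0
    · exact Or.inl h0
    by_cases h1 : x = Fin.last n
    · exact Or.inr (Or.inl h1)
    refine Or.inr (Or.inr (mem_cuts.mpr ⟨Finset.mem_Ico.mpr ⟨?_, ?_⟩, x, hx, rfl⟩))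
    · exact Nat.one_le_iff_ne_zero.mpr fun h => h0 (Fin.ext h)
    · exact lt_of_le_of_ne (Nat.lt_succ_iff.mp x.2) fun h => h1 (Fin.ext h)
  · rintro (rfl | rfl | h)
    · exact c.toCompositionAsSet.zero_mem
    · exact c.toCompositionAsSet.getLast_mem
    · obtain ⟨-, y, hy, h⟩ := mem_cuts.mp h
      rwa [← Fin.ext h]

theorem cuts_injective {n : ℕ} : Function.Injective (cuts (n := n)) := by
  intro c d h
  apply (compositionEquiv n).injective
  apply CompositionAsSet.ext
  change c.boundaries = d.boundaries
  ext x
  rw [mem_boundaries_iff, mem_boundaries_iff, h]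

theorem exists_cuts_eq {n : ℕ} {C : Finset ℕ} (hC : C ⊆ Finset.Ico 1 n) :
    ∃ c : Composition n, cuts c = C := by
  let D : CompositionAsSet n :=
    ⟨Finset.univ.filter fun x => x = 0 ∨ x = Fin.last n ∨ x.val ∈ C, by simp, by simp⟩
  refine ⟨D.toComposition, ?_⟩
  ext k
  rw [mem_cuts, D.toComposition_boundaries]
  simp only [D, Finset.mem_filter, Finset.mem_univ, true_and]
  constructor
  · rintro ⟨h1, x, (rfl | rfl | h), rfl⟩
    · simp at h1
    · simp at h1
    · exact h
  · intro hk
    have h1 := Finset.mem_Ico.mp (hC hk)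
    exact ⟨hC hk, ⟨k, by omega⟩, Or.inr (Or.inr hk), rfl⟩

/-- Subsets replace compositions so that a single cut can be inserted or removed freely. -/
theorem sum_cuts {n : ℕ} (φ : Finset ℕ → ℚ) :
    ∑ c : Composition n, φ (cuts c) = ∑ C ∈ (Finset.Ico 1 n).powerset, φ C := by
  refine Finset.sum_bij (fun c _ => cuts c) ?_ (fun c _ d _ h => cuts_injective h) ?_
    (fun _ _ => rfl)
  · intro c _
    exact Finset.mem_powerset.mpr fun k hk => (mem_cuts.mp hk).1
  · intro C hC
    obtain ⟨c, hc⟩ := exists_cuts_eq (Finset.mem_powerset.mp hC)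
    exact ⟨c, Finset.mem_univ _, hc⟩

/-! ### Partial sums and block sums -/

/-- The partial sum `α_{≤ k}`. -/
def lowerSum {r n : ℕ} (α : Fin n → S r) (k : ℕ) : Fin r → ℕ :=
  ∑ i : Fin n with i.val < k, (α i).1

theorem lowerSum_zero {r n : ℕ} (α : Fin n → S r) : lowerSum α 0 = 0 := by
  simp [lowerSum]

theorem lowerSum_self {r n : ℕ} (hn : 0 < n) (α : Fin n → S r) :
    lowerSum α n = (total hn α).1 := by
  simp [lowerSum, total]

theorem lowerSum_succ {r n : ℕ} (α : Fin n → S r) {k : ℕ} (hk : k < n) :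
    lowerSum α (k + 1) = lowerSum α k + (α ⟨k, hk⟩).1 := by
  have h : (Finset.univ.filter fun i : Fin n => i.val < k + 1) =
      insert ⟨k, hk⟩ (Finset.univ.filter fun i : Fin n => i.val < k) := by
    ext i
    simp only [Finset.mem_filter, Finset.mem_univ, true_and, Finset.mem_insert, Fin.ext_iff]
    omega
  rw [lowerSum, h, Finset.sum_insert (by simp), add_comm]
  rfl

/-- Cuts of a collapsed tuple are the cuts of the original at block boundaries, so a single function
on the positions of `α` determines all the weights. -/
theorem lowerSum_blockSum {r n : ℕ} (c : Composition n) (α : Fin n → S r) (k : ℕ) :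
    lowerSum (blockSum c α) k = lowerSum α (c.sizeUpTo k) := by
  simp only [lowerSum, Finset.sum_filter]
  rw [← sum_embedding c fun i => if i.val < c.sizeUpTo k then (α i).1 else 0]
  refine Finset.sum_congr rfl fun j _ => ?_
  have h : ∀ i, (c.embedding j i).val < c.sizeUpTo k ↔ j.val < k := by
    intro i
    have h1 : (c.embedding j i).val = c.sizeUpTo j + i := rfl
    have h2 := c.sizeUpTo_succ' j
    have h3 := i.2
    rw [h1]
    constructor
    · intro h
      by_contra h4
      have := c.monotone_sizeUpTo (not_lt.mp h4)
      omega
    · intro h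
      have := c.monotone_sizeUpTo (Nat.succ_le_of_lt h)
      have h5 : (j : ℕ).succ = j + 1 := rfl
      rw [h5] at this
      omega
  simp only [h]
  split_ifs
  · rfl
  · simp

/-- Slopes decrease in all blocks if and only if they decrease at all non-cut points. -/
theorem forall_block_lt_iff {n : ℕ} (c : Composition n) (σ : ℕ → ℝ) :
    (∀ j, ∀ i i' : Fin (c.blocksFun j), i < i' →
      σ (c.embedding j i') < σ (c.embedding j i)) ↔
    ∀ k ∈ Finset.Ico 1 n, k ∉ cuts c → σ k < σ (k - 1) := by
  constructor
  · intro h k hk hkc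
    obtain ⟨h1, h2⟩ := Finset.mem_Ico.mp hk
    let x : Fin n := ⟨k - 1, by omega⟩
    have h3 := c.sizeUpTo_index_le x
    have h4 := c.lt_sizeUpTo_index_succ x
    have h5 := c.sizeUpTo_succ' (c.index x)
    have h8 := (c.index x).2
    have hx : x.val = k - 1 := rfl
    have h9 : ((c.index x).succ : ℕ) = c.index x + 1 := rfl
    rw [h9] at h4
    -- As `k < n` is no cut, the block containing position `k - 1` does not end there, so it also
    -- contains `k`.
    have h6 : k ≠ c.sizeUpTo (c.index x + 1) := by
      intro h6
      rcases (Nat.succ_le_of_lt h8).lt_or_eq with h7 | h7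
      · exact hkc (Finset.mem_image.mpr ⟨c.index x + 1, Finset.mem_Ico.mpr ⟨by omega, h7⟩, h6.symm⟩)
      · rw [show (c.index x : ℕ) + 1 = c.length from h7, c.sizeUpTo_length] at h6
        omega
    have h7 := h (c.index x) ⟨k - 1 - c.sizeUpTo (c.index x), by omega⟩
      ⟨k - c.sizeUpTo (c.index x), by omega⟩ (Fin.mk_lt_mk.mpr (by omega))
    simp only [Composition.coe_embedding] at h7
    rwa [show c.sizeUpTo (c.index x) + (k - c.sizeUpTo (c.index x)) = k by omega,
      show c.sizeUpTo (c.index x) + (k - 1 - c.sizeUpTo (c.index x)) = k - 1 by omega] at h7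
  · intro h j i i' hii
    have adj : ∀ m, m + 1 < c.blocksFun j → σ (c.sizeUpTo j + (m + 1)) < σ (c.sizeUpTo j + m) := by
      intro m hm
      have h2 := c.sizeUpTo_succ' j
      have h3 := c.sizeUpTo_le (j + 1)
      refine h _ (Finset.mem_Ico.mpr ⟨by omega, by omega⟩) fun hc => ?_
      obtain ⟨l, -, hl⟩ := Finset.mem_image.mp hc
      rcases lt_or_ge (j : ℕ) l with h1 | h1
      · have := c.monotone_sizeUpTo (Nat.succ_le_of_lt h1)
        have h5 : (j : ℕ).succ = j + 1 := rfl
        rw [h5] at this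
        omega
      · have := c.monotone_sizeUpTo h1
        omega
    have key : ∀ m, i.val < m → m < c.blocksFun j →
        σ (c.sizeUpTo j + m) < σ (c.sizeUpTo j + i) := by
      intro m hm
      induction m, hm using Nat.le_induction with
      | base => exact adj i
      | succ m hm ih => exact fun hb => (adj m hb).trans (ih (by omega))
    exact key i' hii i'.2

/-! ### The cut weight -/

open Classical in
/-- The weight `(-1)^|C| / (n₀ + 1)` of a finite set `C` on which `v ≥ 0`, where `n₀` is the number
of zeros of `v` on `C`; it is zero if `v` takes a negative value on `C`. -/
noncomputable def cutWeight (C : Finset ℕ) (v : ℕ → ℝ) : ℚ :=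
  if ∀ k ∈ C, 0 ≤ v k then (-1) ^ C.card / (((C.filter fun k => v k = 0).card : ℚ) + 1) else 0

theorem cutWeight_image {C : Finset ℕ} {f : ℕ → ℕ} (hf : Set.InjOn f C) (v : ℕ → ℝ) :
    cutWeight (C.image f) v = cutWeight C fun k => v (f k) := by
  classical
  unfold cutWeight
  rw [Finset.card_image_of_injOn hf, Finset.filter_image, Finset.card_image_of_injOn]
  · simp
  · exact hf.mono (Finset.coe_subset.mpr (Finset.filter_subset _ _))

theorem cutWeight_insert {C : Finset ℕ} {k : ℕ} (hk : k ∉ C) {v : ℕ → ℝ} (hv : 0 < v k) :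
    cutWeight (insert k C) v = -cutWeight C v := by
  classical
  unfold cutWeight
  rw [Finset.card_insert_of_notMem hk, Finset.filter_insert, if_neg hv.ne']
  have h : (∀ j ∈ insert k C, 0 ≤ v j) ↔ ∀ j ∈ C, 0 ≤ v j := by
    simp [hv.le]
  by_cases hC : ∀ j ∈ C, 0 ≤ v j
  · rw [if_pos hC, if_pos (h.mpr hC), pow_succ]
    ring
  · rw [if_neg hC, if_neg (h.not.mpr hC), neg_zero]

open Classical in
/-- The alternating sum over all cut sets containing the non-descents of `σ`. -/
theorem sum_cutWeight {n : ℕ} (hn : 0 < n) (V σ : ℕ → ℝ) (μ : ℝ) (h0 : V 0 = 0) (hV : V n = 0)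
    (hlt : ∀ k < n, V (k + 1) < V k ↔ σ k < μ) (hgt : ∀ k < n, V k < V (k + 1) ↔ μ < σ k) :
    ∑ C ∈ (Finset.Ico 1 n).powerset, cutWeight C V *
        (if ∀ k ∈ Finset.Ico 1 n, k ∉ C → σ k < σ (k - 1) then 1 else 0) =
      if ∀ i < n, ∀ j < n, σ i = σ j then (-1) ^ (n - 1) / (n : ℚ) else 0 := by
  -- Read `V` as a closed path whose step at `k` has the sign of `σ k - μ`. If it is constant, all
  -- `σ k` equal `μ`, there are no descents, and only the full cut set survives.
  by_cases hall : ∀ k ≤ n, V k = 0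
  · have hσ : ∀ k < n, σ k = μ := by
      intro k hk
      have h1 := hall k hk.le
      have h2 := hall (k + 1) hk
      refine le_antisymm (not_lt.mp fun h => ?_) (not_lt.mp fun h => ?_)
      · have := (hgt k hk).mpr h
        linarith
      · have := (hlt k hk).mpr h
        linarith
    rw [if_pos fun i hi j hj => (hσ i hi).trans (hσ j hj).symm,
      Finset.sum_eq_single (Finset.Ico 1 n)]
    · have h1 : ∀ k ∈ Finset.Ico 1 n, V k = 0 := fun k hk => hall k (Finset.mem_Ico.mp hk).2.le
      rw [if_pos fun k hk hk' => absurd hk hk', mul_one, cutWeight,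
        if_pos fun k hk => (h1 k hk).ge, Finset.filter_true_of_mem h1, Nat.card_Ico]
      congr 1
      exact_mod_cast Nat.sub_add_cancel hn
    · intro C hC hne
      apply mul_eq_zero_of_right
      rw [if_neg]
      intro h
      apply hne
      refine (Finset.mem_powerset.mp hC).antisymm fun k hk => ?_
      by_contra hkC
      have h1 := Finset.mem_Ico.mp hk
      have h2 := h k hk hkC
      rw [hσ k h1.2, hσ (k - 1) (by omega)] at h2
      exact lt_irrefl _ h2
    · simp
  -- With equal slopes the path would be strictly monotone, hence not closed, or identically zero.
  have hne : ¬ ∀ i < n, ∀ j < n, σ i = σ j := by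
    intro h
    have hs : ∀ k < n, σ k = σ 0 := fun k hk => h k hk 0 hn
    rcases lt_trichotomy (σ 0) μ with h1 | h1 | h1
    · have : ∀ k, k + 1 ≤ n → V (k + 1) < 0 := by
        intro k
        induction k with
        | zero => exact fun hk => ((hlt 0 hk).mpr h1).trans_eq h0
        | succ k ih =>
          exact fun hk => ((hlt _ hk).mpr (by rwa [hs _ hk])).trans (ih (by omega))
      have := this (n - 1) (by omega)
      rw [Nat.sub_add_cancel hn] at this
      linarith
    · apply hall
      intro k
      induction k with
      | zero => exact fun _ => h0
      | succ k ih =>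
        intro hk
        have h2 := ih (by omega)
        have h3 := hs k hk
        refine le_antisymm (not_lt.mp fun h => ?_) (not_lt.mp fun h => ?_)
        · have := (hgt k hk).mp (by linarith)
          linarith
        · have := (hlt k hk).mp (by linarith)
          linarith
    · have : ∀ k, k + 1 ≤ n → 0 < V (k + 1) := by
        intro k
        induction k with
        | zero => exact fun hk => h0.symm.trans_lt ((hgt 0 hk).mpr h1)
        | succ k ih =>
          exact fun hk => (ih (by omega)).trans ((hgt _ hk).mpr (by rwa [hs _ hk]))
      have := this (n - 1) (by omega)
      rw [Nat.sub_add_cancel hn] at this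
      linarith
  rw [if_neg hne]
  -- In a nonzero term no cut is at a negative position. The first negative position is entered by a
  -- step down, so `σ < μ` there; every later position is then a non-cut, hence a descent, and the
  -- path never returns to 0.
  by_cases hneg : ∃ k ≤ n, V k < 0
  · refine Finset.sum_eq_zero fun C hC => ?_
    by_contra hC0
    have hw : ∀ k ∈ C, 0 ≤ V k := by
      by_contra h
      exact hC0 (mul_eq_zero_of_left (if_neg h) _)
    have hd : ∀ k ∈ Finset.Ico 1 n, k ∉ C → σ k < σ (k - 1) := by
      by_contra h
      exact hC0 (mul_eq_zero_of_right _ (if_neg h))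
    obtain ⟨hk, hVk⟩ := Nat.find_spec hneg
    have hmin := fun m => Nat.find_min hneg (m := m)
    set k := Nat.find hneg
    have hk0 : k ≠ 0 := by
      intro h
      rw [h, h0] at hVk
      exact lt_irrefl _ hVk
    obtain ⟨m, hm⟩ := Nat.exists_eq_succ_of_ne_zero hk0
    have key : ∀ j, k ≤ j → j ≤ n → V j < 0 ∧ σ (j - 1) < μ := by
      intro j hj
      induction j, hj using Nat.le_induction with
      | base =>
        refine fun _ => ⟨hVk, ?_⟩
        have h1 : ¬ V m < 0 := fun h => hmin m (by omega) ⟨by omega, h⟩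
        rw [hm] at hVk ⊢
        exact (hlt m (by omega)).mp (by linarith)
      | succ j hj ih =>
        intro hjn
        obtain ⟨h1, h2⟩ := ih (by omega)
        have h3 := hd j (Finset.mem_Ico.mpr ⟨by omega, by omega⟩)
          fun h => absurd (hw j h) (not_le.mpr h1)
        have h4 := h3.trans h2
        exact ⟨((hlt j (by omega)).mpr h4).trans h1, h4⟩
    have := (key n hk le_rfl).1
    linarith
  · push Not at hneg
    -- The pivot of a sign-reversing involution. Without it, `σ` would not descend at positive
    -- positions; a step down from one could be traced back to `V 0 > 0`, so the path, once
    -- positive, would stay positive.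
    obtain ⟨k, hk, hVk, hσk⟩ : ∃ k ∈ Finset.Ico 1 n, 0 < V k ∧ σ k < σ (k - 1) := by
      by_contra hcon
      push Not at hcon
      have key : ∀ j, j < n → 0 < V j → σ j < μ → False := by
        intro j
        induction j with
        | zero => exact fun _ h => absurd h (by rw [h0]; exact lt_irrefl _)
        | succ j ih =>
          intro hj h1 h2
          have h3 := hcon (j + 1) (Finset.mem_Ico.mpr ⟨by omega, hj⟩) h1
          have h4 : σ j < μ := h3.trans_lt h2
          exact ih (by omega) (h1.trans ((hlt j (by omega)).mpr h4)) h4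
      apply hall
      intro k hk
      refine le_antisymm (not_lt.mp fun h => ?_) (hneg k hk)
      have : ∀ j, k ≤ j → j ≤ n → 0 < V j := by
        intro j hj
        induction j, hj using Nat.le_induction with
        | base => exact fun _ => h
        | succ j hj ih =>
          intro hjn
          have h1 := ih (by omega)
          have h2 : ¬ σ j < μ := fun h => key j (by omega) h1 h
          have h3 := (hlt j (by omega)).not.mpr h2
          linarith
      have := this n hk le_rfl
      linarith
    -- Pair `C` with `insert k C`: the weight changes sign because `V k > 0`, and the descent
    -- condition is unaffected because `k` is a descent.
    rw [← Finset.insert_erase hk, Finset.sum_powerset_insert (Finset.notMem_erase _ _),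
      ← Finset.sum_add_distrib, Finset.insert_erase hk]
    refine Finset.sum_eq_zero fun C hC => ?_
    have hkC : k ∉ C := fun h => Finset.notMem_erase _ _ (Finset.mem_powerset.mp hC h)
    rw [cutWeight_insert hkC hVk]
    have : (∀ j ∈ Finset.Ico 1 n, j ∉ insert k C → σ j < σ (j - 1)) ↔
        ∀ j ∈ Finset.Ico 1 n, j ∉ C → σ j < σ (j - 1) := by
      refine ⟨fun h j hj hjC => ?_, fun h j hj hjC => h j hj fun h' =>
        hjC (Finset.mem_insert_of_mem h')⟩
      by_cases hjk : j = k
      · rwa [hjk]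
      · exact h j hj (by simp [hjk, hjC])
    by_cases hd : ∀ j ∈ Finset.Ico 1 n, j ∉ C → σ j < σ (j - 1)
    · rw [if_pos hd, if_pos (this.mpr hd)]
      ring
    · rw [if_neg hd, if_neg (this.not.mpr hd)]
      ring

/-! ### The explicit form of `g_Z` -/

namespace CentralCharge

/-- The additive function `(θ · a) (ρ · b) - (θ · b) (ρ · a)` of `a`, which is positive if and only
if the slope of `a` is larger than that of `b`. -/
noncomputable def excess (Z : CentralCharge r) (b a : Fin r → ℕ) : ℝ :=
  (∑ k, Z.θ k * (a k : ℝ)) * (∑ k, Z.ρ k * (b k : ℝ)) -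
    (∑ k, Z.θ k * (b k : ℝ)) * (∑ k, Z.ρ k * (a k : ℝ))

theorem excess_add (Z : CentralCharge r) (b a a' : Fin r → ℕ) :
    Z.excess b (a + a') = Z.excess b a + Z.excess b a' := by
  simp only [excess, Pi.add_apply, Nat.cast_add, mul_add, Finset.sum_add_distrib]
  ring

theorem excess_self (Z : CentralCharge r) (b : Fin r → ℕ) : Z.excess b b = 0 := by
  simp [excess]

theorem excess_zero (Z : CentralCharge r) (b : Fin r → ℕ) : Z.excess b 0 = 0 := by
  simp [excess]

theorem rho_pos (Z : CentralCharge r) (a : S r) : 0 < ∑ k, Z.ρ k * (a.1 k : ℝ) := by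
  obtain ⟨k, hk⟩ := Function.ne_iff.mp a.2
  refine Finset.sum_pos' (fun i _ => mul_nonneg (Z.ρ_pos i).le (Nat.cast_nonneg _))
    ⟨k, Finset.mem_univ _, mul_pos (Z.ρ_pos k) ?_⟩
  exact_mod_cast Nat.pos_of_ne_zero hk

theorem excess_neg_iff (Z : CentralCharge r) (b a : S r) :
    Z.excess b.1 a.1 < 0 ↔ Z.slope a < Z.slope b := by
  rw [slope, slope, div_lt_div_iff₀ (Z.rho_pos a) (Z.rho_pos b), excess, sub_neg]

theorem excess_pos_iff (Z : CentralCharge r) (b a : S r) :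
    0 < Z.excess b.1 a.1 ↔ Z.slope b < Z.slope a := by
  rw [slope, slope, div_lt_div_iff₀ (Z.rho_pos b) (Z.rho_pos a), excess, sub_pos]

/-- The explicit form of `g_Z`. -/
noncomputable def cutCol (Z : CentralCharge r) : Col r := fun n α =>
  cutWeight (Finset.Ico 1 (n : ℕ)) fun k => Z.excess (total n.pos α).1 (lowerSum α k)

theorem cutCol_blockSum (Z : CentralCharge r) {n : ℕ} (hn : 0 < n) (c : Composition n)
    (α : Fin n → S r) :
    Z.cutCol ⟨c.length, c.length_pos_of_pos hn⟩ (blockSum c α) =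
      cutWeight (cuts c) fun k => Z.excess (total hn α).1 (lowerSum α k) := by
  rw [cuts, cutWeight_image (sizeUpTo_injOn c)]
  have h := total_blockSum c hn α
  change cutWeight (Finset.Ico 1 c.length) (fun k => Z.excess
    (total (c.length_pos_of_pos hn) (blockSum c α)).1 (lowerSum (blockSum c α) k)) = _
  simp only [h, lowerSum_blockSum]

open Classical in
theorem prod_hn_embedding (Z : CentralCharge r) {n : ℕ} (c : Composition n) (α : Fin n → S r)
    (σ : ℕ → ℝ) (hσ : ∀ i : Fin n, σ i = Z.slope (α i)) :
    ∏ j, Z.hn ⟨c.blocksFun j, c.one_le_blocksFun j⟩ (fun i => α (c.embedding j i)) =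
      if ∀ k ∈ Finset.Ico 1 n, k ∉ cuts c → σ k < σ (k - 1) then 1 else 0 := by
  have h := forall_block_lt_iff c σ
  simp only [hσ] at h
  by_cases hd : ∀ k ∈ Finset.Ico 1 n, k ∉ cuts c → σ k < σ (k - 1)
  · rw [if_pos hd]
    exact Finset.prod_eq_one fun j _ => if_pos (h.mpr hd j)
  · rw [if_neg hd]
    obtain ⟨j, hj⟩ := not_forall.mp (h.not.mpr hd)
    exact Finset.prod_eq_zero (Finset.mem_univ j) (if_neg hj)

/-- A composition contributes the weight of its cut set exactly when slopes descend at all non-cuts.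
The excess of the partial sums is the closed path needed for `sum_cutWeight`, as the total has no
excess over itself. -/
theorem pleth_cutCol_hn (Z : CentralCharge r) : pleth Z.cutCol Z.hn = Z.log := by
  classical
  funext n α
  -- The default 0 is harmless: only indices below `n` enter the conditions.
  let σ : ℕ → ℝ := fun i => if h : i < n then Z.slope (α ⟨i, h⟩) else 0
  have hσ : ∀ i : Fin n, σ i = Z.slope (α i) := fun i => by simp [σ]
  have h1 : pleth Z.cutCol Z.hn n α = ∑ c : Composition n,
      cutWeight (cuts c) (fun k => Z.excess (total n.pos α).1 (lowerSum α k)) *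
        (if ∀ k ∈ Finset.Ico 1 (n : ℕ), k ∉ cuts c → σ k < σ (k - 1) then 1 else 0) := by
    refine Finset.sum_congr rfl fun c _ => ?_
    rw [← prod_hn_embedding Z c α σ hσ, ← cutCol_blockSum Z n.pos]
  rw [h1, sum_cuts fun C => cutWeight C (fun k => Z.excess (total n.pos α).1 (lowerSum α k)) *
        (if ∀ k ∈ Finset.Ico 1 (n : ℕ), k ∉ C → σ k < σ (k - 1) then 1 else 0),
    sum_cutWeight n.pos _ σ (Z.slope (total n.pos α))]
  · rw [log]
    refine if_congr ?_ rfl rfl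
    constructor
    · intro h i j
      rw [← hσ, ← hσ]
      exact h i i.2 j j.2
    · intro h i hi j hj
      have := h ⟨i, hi⟩ ⟨j, hj⟩
      rwa [← hσ, ← hσ] at this
  · rw [lowerSum_zero, excess_zero]
  · rw [lowerSum_self n.pos, excess_self]
  · intro k hk
    rw [lowerSum_succ α hk, excess_add, add_lt_iff_neg_left, excess_neg_iff, ← hσ]
  · intro k hk
    rw [lowerSum_succ α hk, excess_add, lt_add_iff_pos_right, excess_pos_iff, ← hσ]

theorem hn_one (Z : CentralCharge r) (n : ℕ+) (α : Fin n → S r) (h : (n : ℕ) = 1) :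
    Z.hn n α = 1 := by
  refine if_pos fun i j hij => ?_
  have h1 := i.2
  have h2 := j.2
  have h3 : i.val < j.val := hij
  omega

theorem g_eq_cutCol (Z : CentralCharge r) : Z.g = Z.cutCol := by
  rw [g, ← pleth_cutCol_hn, pleth_assoc, (isPlethInv_plethInv _ Z.hn_one).1, pleth_idCol]

/-- Since A = s_Z * A_Z, the factor s_Z in log_Z = `cutCol` ∘ s_Z is absorbed by the action. -/
theorem rationalDT_eq_act {R : Type*} [Ring R] [Algebra ℚ R] (Z : CentralCharge r) (A : S r → R) :
    Z.rationalDT A = act Z.cutCol A := by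
  conv_rhs => rw [eq_act_hn_stackyDT Z A]
  rw [← act_pleth, pleth_cutCol_hn, rationalDT]

theorem g_one (Z : CentralCharge r) (n : ℕ+) (α : Fin n → S r) (h : (n : ℕ) = 1) :
    Z.g n α = 1 := by
  have h1 : Finset.Ico 1 (n : ℕ) = ∅ := by simp [h]
  rw [g_eq_cutCol, cutCol, h1]
  simp [cutWeight]

end CentralCharge

/-! ### Cyclic rotations -/

/-- Counting the trivial cut 0 as a zero absorbs the `+ 1` in the denominator, so the weight lives
on the cyclic index set `Fin n`. -/
theorem cutWeight_Ico {n : ℕ} [NeZero n] (w : ℕ → ℝ) (h0 : w 0 = 0) :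
    cutWeight (Finset.Ico 1 n) w = if ∀ j : Fin n, 0 ≤ w j then
      (-1) ^ (n - 1) / ((Finset.univ.filter fun j : Fin n => w j = 0).card : ℚ) else 0 := by
  classical
  have hn : 0 < n := Nat.pos_of_neZero n
  have h1 : (∀ k ∈ Finset.Ico 1 n, 0 ≤ w k) ↔ ∀ j : Fin n, 0 ≤ w j := by
    constructor
    · intro h j
      rcases Nat.eq_zero_or_pos j.val with hj | hj
      · rw [hj, h0]
      · exact h j (Finset.mem_Ico.mpr ⟨hj, j.2⟩)
    · intro h k hk
      exact h ⟨k, (Finset.mem_Ico.mp hk).2⟩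
  have h2 : ((Finset.Ico 1 n).filter fun k => w k = 0).card + 1 =
      (Finset.univ.filter fun j : Fin n => w j = 0).card := by
    rw [← Finset.card_map Fin.valEmbedding, ← Finset.card_insert_of_notMem (a := 0) (by simp)]
    congr 1
    ext k
    simp only [Finset.mem_insert, Finset.mem_filter, Finset.mem_Ico, Finset.mem_map,
      Finset.mem_univ, true_and, Fin.valEmbedding_apply]
    constructor
    · rintro (rfl | ⟨⟨h, h'⟩, h''⟩)
      · exact ⟨⟨0, hn⟩, h0, rfl⟩
      · exact ⟨⟨k, h'⟩, h'', rfl⟩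
    · rintro ⟨j, hj, rfl⟩
      rcases Nat.eq_zero_or_pos j.val with h | h
      · exact Or.inl h
      · exact Or.inr ⟨⟨h, j.2⟩, hj⟩
  unfold cutWeight
  by_cases h : ∀ j : Fin n, 0 ≤ w j
  · rw [if_pos h, if_pos (h1.mpr h), Nat.card_Ico, ← h2, Nat.cast_succ]
  · rw [if_neg h, if_neg (h1.not.mpr h)]

/-- Among the cyclic rotations of a closed path, exactly those that start at a minimum stay
non-negative. -/
theorem sum_cyclic {n : ℕ} [NeZero n] (v : Fin n → ℝ) (K : Finset (Fin n))
    (hK : ∀ p, (∀ q, v p ≤ v q) → p ∈ K) (x : ℚ) :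
    ∑ k ∈ K, (if ∀ j, 0 ≤ v (j + k) - v k then
      x / ((Finset.univ.filter fun j => v (j + k) - v k = 0).card : ℚ) else 0) = x := by
  classical
  set M : Finset (Fin n) := Finset.univ.filter fun p => ∀ q, v p ≤ v q with hM
  have hne : M.Nonempty := by
    obtain ⟨p, -, hp⟩ := Finset.exists_min_image Finset.univ v ⟨0, Finset.mem_univ _⟩
    exact ⟨p, by simpa [hM] using hp⟩
  have hMK : M ⊆ K := fun p hp => hK p (Finset.mem_filter.mp hp).2
  -- The zeros of a rotation based at a minimum are the other base points in `M` and itself, so each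
  -- of the `M.card` minima contributes `x / M.card`.
  have hiff : ∀ k, (∀ j, 0 ≤ v (j + k) - v k) ↔ k ∈ M := by
    intro k
    simp only [hM, Finset.mem_filter, Finset.mem_univ, true_and, sub_nonneg]
    exact ⟨fun h q => by simpa using h (q - k), fun h j => h _⟩
  have hcard : ∀ k ∈ M, (Finset.univ.filter fun j => v (j + k) - v k = 0).card = M.card := by
    intro k hk
    refine Finset.card_bij (fun j _ => j + k) ?_ (fun _ _ _ _ h => add_right_cancel h) ?_
    · intro j hj
      have h1 := (Finset.mem_filter.mp hj).2
      have h2 := (Finset.mem_filter.mp hk).2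
      rw [sub_eq_zero] at h1
      simpa [hM, h1] using h2
    · intro p hp
      have h1 := (Finset.mem_filter.mp hp).2 k
      have h2 := (Finset.mem_filter.mp hk).2 p
      exact ⟨p - k, by simp [le_antisymm h1 h2], by simp⟩
  rw [← Finset.sum_subset hMK fun k _ hk => if_neg ((hiff k).not.mpr hk)]
  have : ∀ k ∈ M, (if ∀ j, 0 ≤ v (j + k) - v k then
      x / ((Finset.univ.filter fun j => v (j + k) - v k = 0).card : ℚ) else 0) = x / M.card := by
    intro k hk
    rw [if_pos ((hiff k).mpr hk), hcard k hk]
  rw [Finset.sum_congr rfl this, Finset.sum_const, nsmul_eq_mul]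
  have : (M.card : ℚ) ≠ 0 := by exact_mod_cast hne.card_pos.ne'
  field_simp

/-- The cyclic rotation of a tuple. -/
def rot {n : ℕ} [NeZero n] (k : Fin n) (α : Fin n → S r) : Fin n → S r := fun i => α (i + k)

theorem rot_neg_rot {n : ℕ} [NeZero n] (k : Fin n) (α : Fin n → S r) : rot (-k) (rot k α) = α := by
  funext i
  simp [rot]

theorem total_rot {n : ℕ} [NeZero n] (hn : 0 < n) (k : Fin n) (α : Fin n → S r) :
    total hn (rot k α) = total hn α :=
  Subtype.ext (Equiv.sum_comp (Equiv.addRight k) fun i => (α i).1)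

/-- Since `f` kills the total, its values on partial sums form a closed path, and rotation only
moves the base point. -/
theorem map_lowerSum_rot {n : ℕ} [NeZero n] (hn : 0 < n) (f : (Fin r → ℕ) → ℝ)
    (hf : ∀ a b, f (a + b) = f a + f b) (k : Fin n) (α : Fin n → S r)
    (h : f (total hn α).1 = 0) (j : Fin n) :
    f (lowerSum (rot k α) j) = f (lowerSum α (j + k : Fin n)) - f (lowerSum α k) := by
  have hf0 : f 0 = 0 := by
    have := hf 0 0
    rw [add_zero] at this
    linarith
  have key : ∀ m < n, f (lowerSum (rot k α) m) =
      f (lowerSum α ((m + k) % n)) - f (lowerSum α k) := by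
    intro m
    induction m with
    | zero =>
      intro _
      rw [lowerSum_zero, hf0, zero_add, Nat.mod_eq_of_lt k.2, sub_self]
    | succ m ih =>
      intro hm
      have hlt := Nat.mod_lt (m + k) hn
      have h1 : f (lowerSum α ((m + 1 + k) % n)) =
          f (lowerSum α ((m + k) % n)) + f (α ⟨(m + k) % n, hlt⟩).1 := by
        rw [← hf, ← lowerSum_succ, show m + 1 + k = m + k + 1 by ring, ← Nat.mod_add_mod]
        -- At the wrap-around the partial sum drops from the total to 0, which `f` does not see.
        rcases (Nat.succ_le_of_lt hlt).lt_or_eq with h1 | h1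
        · rw [Nat.mod_eq_of_lt h1]
        · have h1' : (m + k) % n + 1 = n := h1
          rw [h1', Nat.mod_self, lowerSum_zero, lowerSum_self hn, h, hf0]
      have h2 : rot k α ⟨m, by omega⟩ = α ⟨(m + k) % n, hlt⟩ := by
        rw [rot]
        congr 1
      rw [lowerSum_succ _ (show m < n by omega), hf, ih (by omega), h1, h2]
      ring
  have := key j j.2
  rwa [Fin.val_add]

theorem ofFn_rot {X : Type*} {n : ℕ} [NeZero n] (k : Fin n) (x : Fin n → X) :
    (List.ofFn fun i => x (i + k)) = (List.ofFn x).rotate k := by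
  apply List.ext_getElem
  · simp
  · intro i h1 h2
    simp only [List.getElem_ofFn, List.getElem_rotate, List.length_ofFn]
    congr 1

/-! ### Rotated products in the graded algebra -/

section Graded

theorem toLattice_add (a b : Fin r → ℕ) : toLattice (a + b) = toLattice a + toLattice b := by
  funext i
  simp [toLattice]

variable {R : Type*} [Ring R] [Algebra ℚ R] (𝒜 : (Fin r → ℕ) → Submodule ℚ R) [GradedAlgebra 𝒜]

theorem sum_map_ne_zero {l : List (S r)} (hl : l ≠ []) : (l.map Subtype.val).sum ≠ 0 := by
  intro h
  obtain ⟨a, t, rfl⟩ := List.exists_cons_of_ne_nil hl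
  rw [List.map_cons, List.sum_cons] at h
  apply a.2
  funext k
  have := congrFun h k
  simp only [Pi.add_apply, Pi.zero_apply] at this ⊢
  omega

/-- Rotating at a cut with zero pairing does not change the product. -/
theorem prod_rot (B : LinearMap.BilinForm ℤ (Fin r → ℤ)) (hB : ∀ a b, B a b = -B b a)
    (hcomm : ∀ γ γ' : S r, B (toLattice γ.1) (toLattice γ'.1) = 0 →
      ∀ x ∈ 𝒜 γ.1, ∀ y ∈ 𝒜 γ'.1, x * y = y * x)
    (A : S r → R) (hA : ∀ γ, A γ ∈ 𝒜 γ.1) {n : ℕ} [NeZero n] (hn : 0 < n) (k : Fin n)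
    (α : Fin n → S r)
    (hk : B (toLattice (lowerSum α k)) (toLattice (total hn α).1) = 0) :
    (List.ofFn fun i => A (rot k α i)).prod = (List.ofFn fun i => A (α i)).prod := by
  have h1 : (List.ofFn fun i => A (rot k α i)) = (List.ofFn fun i => A (α i)).rotate k :=
    ofFn_rot k fun i => A (α i)
  have h2 : (List.ofFn fun i => A (α i)) = (List.ofFn α).map A := by
    rw [List.map_ofFn]
    rfl
  rw [h1, h2, List.rotate_eq_drop_append_take (by simp), ← List.map_drop, ← List.map_take,
    List.prod_append]
  set l := (List.ofFn α).take k with hl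
  set l' := (List.ofFn α).drop k with hl'
  have h3 : l ++ l' = List.ofFn α := List.take_append_drop _ _
  rw [← h3, List.map_append, List.prod_append]
  rcases eq_or_ne l [] with h | h
  · simp [h]
  rcases eq_or_ne l' [] with h' | h'
  · simp [h']
  have hsum : (l.map Subtype.val).sum = lowerSum α k := by
    rw [hl, List.map_take, List.map_ofFn, List.sum_take_ofFn]
    rfl
  have htot : (l.map Subtype.val).sum + (l'.map Subtype.val).sum = (total hn α).1 := by
    rw [← List.sum_append, ← List.map_append, h3, List.map_ofFn, List.sum_ofFn]
    rfl
  -- The two halves have homogeneous products. By skew-symmetry the pairing of the lower half with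
  -- the total equals its pairing with the upper half, so these products commute.
  refine (hcomm ⟨_, sum_map_ne_zero h⟩ ⟨_, sum_map_ne_zero h'⟩ ?_ _
    (SetLike.list_prod_map_mem_graded l _ _ fun a _ => hA a) _
    (SetLike.list_prod_map_mem_graded l' _ _ fun a _ => hA a)).symm
  rw [← hsum, ← htot] at hk
  have h5 := hB (toLattice (l.map Subtype.val).sum) (toLattice (l.map Subtype.val).sum)
  rw [toLattice_add, map_add] at hk
  change B (toLattice (l.map Subtype.val).sum) (toLattice (l'.map Subtype.val).sum) = 0
  omega

end Graded

/-! ### The attractor collection -/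

/-- The pairing `⟨a, γ⟩` as a real number. -/
def pairing (B : LinearMap.BilinForm ℤ (Fin r → ℤ)) (γ a : Fin r → ℕ) : ℝ :=
  (B (toLattice a) (toLattice γ) : ℤ)

theorem pairing_add (B : LinearMap.BilinForm ℤ (Fin r → ℤ)) (γ a b : Fin r → ℕ) :
    pairing B γ (a + b) = pairing B γ a + pairing B γ b := by
  simp [pairing, toLattice_add]

theorem pairing_zero (B : LinearMap.BilinForm ℤ (Fin r → ℤ)) (γ : Fin r → ℕ) :
    pairing B γ 0 = 0 := by
  have := pairing_add B γ 0 0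
  rw [add_zero] at this
  linarith

theorem pairing_self (B : LinearMap.BilinForm ℤ (Fin r → ℤ)) (hB : ∀ a b, B a b = -B b a)
    (γ : Fin r → ℕ) : pairing B γ γ = 0 := by
  have := hB (toLattice γ) (toLattice γ)
  rw [pairing, show B (toLattice γ) (toLattice γ) = 0 by omega, Int.cast_zero]

/-- The self-pairing of α_{≤k} vanishes, so the upper part may be completed to the total. This makes
the cut value additive in the partial sum, as in `cutCol`. -/
theorem cutPairing_eq (B : LinearMap.BilinForm ℤ (Fin r → ℤ)) (hB : ∀ a b, B a b = -B b a)
    {n : ℕ} (hn : 0 < n) (α : Fin n → S r) (k : ℕ) :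
    (cutPairing B α k : ℝ) = pairing B (total hn α).1 (lowerSum α k) := by
  have h : (total hn α).1 = lowerSum α k + ∑ i : Fin n with k ≤ i.val, (α i).1 := by
    have := Finset.sum_filter_add_sum_filter_not Finset.univ (fun i : Fin n => i.val < k)
      fun i => (α i).1
    simp only [not_lt] at this
    exact this.symm
  have h1 := hB (toLattice (lowerSum α k)) (toLattice (lowerSum α k))
  rw [pairing, h, toLattice_add, map_add, show
    B (toLattice (lowerSum α k)) (toLattice (lowerSum α k)) = 0 by omega, zero_add]
  rfl

theorem attractorCol_eq (B : LinearMap.BilinForm ℤ (Fin r → ℤ)) (hB : ∀ a b, B a b = -B b a)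
    (n : ℕ+) (α : Fin n → S r) :
    attractorCol B n α =
      cutWeight (Finset.Ico 1 (n : ℕ)) fun k => pairing B (total n.pos α).1 (lowerSum α k) := by
  classical
  unfold attractorCol cutWeight
  simp only [← cutPairing_eq B hB n.pos, Nat.card_Ico]
  have h1 : ∀ k, (0 : ℝ) ≤ cutPairing B α k ↔ 0 ≤ cutPairing B α k := fun k => Int.cast_nonneg_iff
  have h2 : ∀ k, (cutPairing B α k : ℝ) = 0 ↔ cutPairing B α k = 0 := fun k => Int.cast_eq_zero
  simp only [h1, h2]

theorem attractorCol_one (B : LinearMap.BilinForm ℤ (Fin r → ℤ)) (n : ℕ+) (α : Fin n → S r)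
    (h : (n : ℕ) = 1) : attractorCol B n α = 1 := by
  simp [attractorCol, h]

/-! ### Perturbations of the self-stability -/

theorem sum_selfStability (B : LinearMap.BilinForm ℤ (Fin r → ℤ)) (γ : S r) (a : Fin r → ℕ) :
    ∑ k, selfStability B γ k * (a k : ℝ) = pairing B γ.1 a := by
  have h : toLattice a = ∑ k, (a k : ℤ) • Pi.single k (1 : ℤ) := by
    funext i
    simp [toLattice, Pi.single_apply, Finset.sum_apply]
  rw [pairing, h, map_sum, LinearMap.sum_apply, Int.cast_sum]
  refine Finset.sum_congr rfl fun k _ => ?_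
  rw [map_smul, LinearMap.smul_apply, smul_eq_mul, Int.cast_mul, Int.cast_natCast, mul_comm]
  rfl

/-- Near the self-stability, the excess has the sign of the pairing. -/
def IsPerturbation (B : LinearMap.BilinForm ℤ (Fin r → ℤ)) (γ : S r) (θ : Fin r → ℝ) : Prop :=
  ∀ a ≤ γ.1, (0 < pairing B γ.1 a → 0 < (CentralCharge.ofTheta θ).excess γ.1 a) ∧
    (pairing B γ.1 a < 0 → (CentralCharge.ofTheta θ).excess γ.1 a < 0)

theorem eventually_isPerturbation (B : LinearMap.BilinForm ℤ (Fin r → ℤ))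
    (hB : ∀ a b, B a b = -B b a) (γ : S r) :
    ∀ᶠ θ in 𝓝 (selfStability B γ), IsPerturbation B γ θ := by
  have hc : ∀ a : Fin r → ℕ,
      Continuous fun θ : Fin r → ℝ => (CentralCharge.ofTheta θ).excess γ.1 a := by
    intro a
    unfold CentralCharge.excess CentralCharge.ofTheta
    fun_prop
  -- As ⟨γ,γ⟩ = 0, the excess at the self-stability is the pairing times the positive degree of `γ`.
  -- Nonzero signs persist nearby by continuity, uniformly over the finitely many `a ≤ γ`.
  have hv : ∀ a : Fin r → ℕ, (CentralCharge.ofTheta (selfStability B γ)).excess γ.1 a =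
      pairing B γ.1 a * ∑ k, (1 : ℝ) * (γ.1 k : ℝ) := by
    intro a
    have h1 := sum_selfStability B γ a
    have h2 := sum_selfStability B γ γ.1
    rw [pairing_self B hB] at h2
    simp only [CentralCharge.excess, CentralCharge.ofTheta, h1, h2, zero_mul, sub_zero]
  have hpos : 0 < ∑ k, (1 : ℝ) * (γ.1 k : ℝ) :=
    (CentralCharge.ofTheta (selfStability B γ)).rho_pos γ
  have : ∀ᶠ θ in 𝓝 (selfStability B γ), ∀ a ∈ Finset.Iic γ.1,
      (0 < pairing B γ.1 a → 0 < (CentralCharge.ofTheta θ).excess γ.1 a) ∧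
      (pairing B γ.1 a < 0 → (CentralCharge.ofTheta θ).excess γ.1 a < 0) := by
    rw [Filter.eventually_all_finset]
    intro a _
    rw [Filter.eventually_and, Filter.eventually_imp_distrib_left,
      Filter.eventually_imp_distrib_left]
    refine ⟨fun h => (hc a).continuousAt.eventually_const_lt ?_,
      fun h => (hc a).continuousAt.eventually_lt_const ?_⟩
    · exact (mul_pos h hpos).trans_eq (hv a).symm
    · exact (hv a).trans_lt (mul_neg_of_neg_of_pos h hpos)
  filter_upwards [this] with θ h a ha using h a (Finset.mem_Iic.mpr ha)

/-- The tuple has non-negative pairings at all cuts. -/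
def NonnegCuts (B : LinearMap.BilinForm ℤ (Fin r → ℤ)) {n : ℕ} (γ : S r) (α : Fin n → S r) : Prop :=
  ∀ j : Fin n, 0 ≤ pairing B γ.1 (lowerSum α j)

open Classical in
/-- The cuts with zero pairing, including the trivial one. -/
noncomputable def zeroCuts (B : LinearMap.BilinForm ℤ (Fin r → ℤ)) {n : ℕ} (γ : S r)
    (α : Fin n → S r) : Finset (Fin n) :=
  Finset.univ.filter fun j => pairing B γ.1 (lowerSum α j) = 0

theorem pairing_lowerSum_rot (B : LinearMap.BilinForm ℤ (Fin r → ℤ))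
    (hB : ∀ a b, B a b = -B b a) {n : ℕ} [NeZero n] (hn : 0 < n) {γ : S r} {α : Fin n → S r}
    (hα : total hn α = γ) {k : Fin n} (hk : k ∈ zeroCuts B γ α) (j : Fin n) :
    pairing B γ.1 (lowerSum (rot k α) j) = pairing B γ.1 (lowerSum α (j + k : Fin n)) := by
  have h := map_lowerSum_rot hn (pairing B γ.1) (pairing_add B γ.1) k α
    (by rw [hα, pairing_self B hB]) j
  rw [h, (Finset.mem_filter.mp hk).2, sub_zero]

theorem nonnegCuts_rot (B : LinearMap.BilinForm ℤ (Fin r → ℤ))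
    (hB : ∀ a b, B a b = -B b a) {n : ℕ} [NeZero n] (hn : 0 < n) {γ : S r} {α : Fin n → S r}
    (hα : total hn α = γ) (h : NonnegCuts B γ α) {k : Fin n} (hk : k ∈ zeroCuts B γ α) :
    NonnegCuts B γ (rot k α) := by
  intro j
  rw [pairing_lowerSum_rot B hB hn hα hk]
  exact h _

theorem neg_mem_zeroCuts_rot (B : LinearMap.BilinForm ℤ (Fin r → ℤ))
    (hB : ∀ a b, B a b = -B b a) {n : ℕ} [NeZero n] (hn : 0 < n) {γ : S r} {α : Fin n → S r}
    (hα : total hn α = γ) {k : Fin n} (hk : k ∈ zeroCuts B γ α) :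
    -k ∈ zeroCuts B γ (rot k α) := by
  refine Finset.mem_filter.mpr ⟨Finset.mem_univ _, ?_⟩
  rw [pairing_lowerSum_rot B hB hn hα hk, neg_add_cancel, Fin.val_zero, lowerSum_zero, pairing_zero]

theorem card_zeroCuts_rot (B : LinearMap.BilinForm ℤ (Fin r → ℤ))
    (hB : ∀ a b, B a b = -B b a) {n : ℕ} [NeZero n] (hn : 0 < n) {γ : S r} {α : Fin n → S r}
    (hα : total hn α = γ) {k : Fin n} (hk : k ∈ zeroCuts B γ α) :
    (zeroCuts B γ (rot k α)).card = (zeroCuts B γ α).card := by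
  unfold zeroCuts
  simp only [pairing_lowerSum_rot B hB hn hα hk]
  refine Finset.card_equiv (Equiv.addRight k) fun j => ?_
  simp

theorem lowerSum_le {n : ℕ} (hn : 0 < n) (α : Fin n → S r) (k : ℕ) :
    lowerSum α k ≤ (total hn α).1 :=
  Finset.sum_le_sum_of_subset (Finset.filter_subset _ _)

open Classical in
theorem attractorCol_eq_ite (B : LinearMap.BilinForm ℤ (Fin r → ℤ)) (hB : ∀ a b, B a b = -B b a)
    (n : ℕ+) (γ : S r) (α : Fin n → S r) (hα : total n.pos α = γ) :
    attractorCol B n α =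
      if NonnegCuts B γ α then (-1) ^ ((n : ℕ) - 1) / ((zeroCuts B γ α).card : ℚ) else 0 := by
  rw [attractorCol_eq B hB, cutWeight_Ico, hα]
  · unfold NonnegCuts zeroCuts
    congr!
  · rw [lowerSum_zero, pairing_zero]

/-- The rotations of a tuple with non-negative cuts have `g_{θ'}`-weights with sum `±1`. -/
theorem sum_cutCol_rot (B : LinearMap.BilinForm ℤ (Fin r → ℤ)) {γ : S r} {θ : Fin r → ℝ}
    (hθ : IsPerturbation B γ θ) (n : ℕ+) (α : Fin n → S r) (hα : total n.pos α = γ)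
    (h : NonnegCuts B γ α) :
    ∑ k ∈ zeroCuts B γ α, (CentralCharge.ofTheta θ).cutCol n (rot k α) =
      (-1) ^ ((n : ℕ) - 1) := by
  classical
  have key := sum_cyclic (fun j : Fin n => (CentralCharge.ofTheta θ).excess γ.1 (lowerSum α j))
    (zeroCuts B γ α) ?_ ((-1) ^ ((n : ℕ) - 1))
  · rw [← key]
    refine Finset.sum_congr rfl fun k _ => ?_
    rw [CentralCharge.cutCol, total_rot, hα, cutWeight_Ico]
    · have h1 : ∀ j : Fin n, (CentralCharge.ofTheta θ).excess γ.1 (lowerSum (rot k α) j) =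
          (CentralCharge.ofTheta θ).excess γ.1 (lowerSum α (j + k : Fin n)) -
            (CentralCharge.ofTheta θ).excess γ.1 (lowerSum α k) := by
        intro j
        exact map_lowerSum_rot n.pos _ (CentralCharge.excess_add _ _) k α
          (by rw [hα, CentralCharge.excess_self]) j
      simp only [h1]
    · rw [lowerSum_zero, CentralCharge.excess_zero]
  -- At a minimum the excess is at most its value 0 at the trivial cut, so the pairing there cannot
  -- be positive; it is non-negative, hence zero.
  · intro p hp
    refine Finset.mem_filter.mpr ⟨Finset.mem_univ _, ?_⟩
    have h1 := hp 0
    rw [Fin.val_zero, lowerSum_zero, CentralCharge.excess_zero] at h1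
    refine ((h p).eq_of_not_lt fun h2 => ?_).symm
    exact not_lt.mpr h1 ((hθ _ (hα ▸ lowerSum_le n.pos α p)).1 h2)

theorem cutCol_eq_zero (B : LinearMap.BilinForm ℤ (Fin r → ℤ)) {γ : S r} {θ : Fin r → ℝ}
    (hθ : IsPerturbation B γ θ) (n : ℕ+) (α : Fin n → S r) (hα : total n.pos α = γ)
    (h : ¬ NonnegCuts B γ α) : (CentralCharge.ofTheta θ).cutCol n α = 0 := by
  rw [CentralCharge.cutCol, hα, cutWeight_Ico]
  · refine if_neg fun h1 => h fun j => not_lt.mp fun h2 => ?_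
    exact not_lt.mpr (h1 j) ((hθ _ (hα ▸ lowerSum_le n.pos α j)).2 h2)
  · rw [lowerSum_zero, CentralCharge.excess_zero]

/-- Rotation of a decomposition with a marked cut. -/
def rotDecomp {γ : S r} (p : Σ α : Decomp γ, Fin α.1.1) : Σ α : Decomp γ, Fin α.1.1 :=
  ⟨⟨⟨p.1.1.1, rot p.2 p.1.1.2⟩, (total_rot p.1.1.1.pos p.2 p.1.1.2).trans p.1.2⟩, -p.2⟩

theorem rotDecomp_involutive {γ : S r} : Function.Involutive (rotDecomp (γ := γ)) := by
  rintro ⟨⟨⟨n, α⟩, hα⟩, k⟩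
  have h : ∀ (β : Fin n → S r) (hβ : total n.pos β = γ) (l : Fin n), β = α → l = k →
      (⟨⟨⟨n, β⟩, hβ⟩, l⟩ : Σ α : Decomp γ, Fin α.1.1) = ⟨⟨⟨n, α⟩, hα⟩, k⟩ := by
    rintro β hβ l rfl rfl
    rfl
  exact h _ _ _ (rot_neg_rot k α) (neg_neg k)

/-- For perturbations of the self-stability, `g_{θ'}` and `g_*` act in the same way. -/
theorem act_cutCol_eq_act_attractorCol (B : LinearMap.BilinForm ℤ (Fin r → ℤ))
    (hB : ∀ a b, B a b = -B b a)
    {R : Type*} [Ring R] [Algebra ℚ R] (𝒜 : (Fin r → ℕ) → Submodule ℚ R) [GradedAlgebra 𝒜]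
    (hcomm : ∀ γ γ' : S r, B (toLattice γ.1) (toLattice γ'.1) = 0 →
      ∀ x ∈ 𝒜 γ.1, ∀ y ∈ 𝒜 γ'.1, x * y = y * x)
    (A : S r → R) (hA : ∀ γ, A γ ∈ 𝒜 γ.1) {γ : S r} {θ : Fin r → ℝ}
    (hθ : IsPerturbation B γ θ) :
    act (CentralCharge.ofTheta θ).cutCol A γ = act (attractorCol B) A γ := by
  classical
  set Z := CentralCharge.ofTheta θ with hZ
  let W : Decomp γ → R := fun α => (List.ofFn fun i => A (α.1.2 i)).prod
  -- Spread the weights over tuples with a marked zero cut: `T'` uses the weight of the tuple, `T`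
  -- that of its rotation at the mark. `rotDecomp` matches the two, since the number of zero cuts
  -- and the product `W` are rotation invariant.
  let T : (Σ α : Decomp γ, Fin α.1.1) → R := fun p =>
    if NonnegCuts B γ p.1.1.2 ∧ p.2 ∈ zeroCuts B γ p.1.1.2 then
      (Z.cutCol p.1.1.1 (rot p.2 p.1.1.2) / ((zeroCuts B γ p.1.1.2).card : ℚ)) • W p.1 else 0
  let T' : (Σ α : Decomp γ, Fin α.1.1) → R := fun p =>
    if NonnegCuts B γ p.1.1.2 ∧ p.2 ∈ zeroCuts B γ p.1.1.2 then
      (Z.cutCol p.1.1.1 p.1.1.2 / ((zeroCuts B γ p.1.1.2).card : ℚ)) • W p.1 else 0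
  have hcond : ∀ p : (Σ α : Decomp γ, Fin α.1.1),
      NonnegCuts B γ p.1.1.2 ∧ p.2 ∈ zeroCuts B γ p.1.1.2 →
      NonnegCuts B γ (rotDecomp p).1.1.2 ∧ (rotDecomp p).2 ∈ zeroCuts B γ (rotDecomp p).1.1.2 :=
    fun p h => ⟨nonnegCuts_rot B hB p.1.1.1.pos p.1.2 h.1 h.2,
      neg_mem_zeroCuts_rot B hB p.1.1.1.pos p.1.2 h.2⟩
  have hTT : ∀ p, T' (rotDecomp p) = T p := by
    intro p
    by_cases h : NonnegCuts B γ p.1.1.2 ∧ p.2 ∈ zeroCuts B γ p.1.1.2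
    · have hc : (zeroCuts B γ (rotDecomp p).1.1.2).card = (zeroCuts B γ p.1.1.2).card :=
        card_zeroCuts_rot B hB p.1.1.1.pos p.1.2 h.2
      have hW : W (rotDecomp p).1 = W p.1 := by
        refine prod_rot 𝒜 B hB hcomm A hA p.1.1.1.pos p.2 p.1.1.2 ?_
        have h1 := (Finset.mem_filter.mp h.2).2
        rw [p.1.2]
        exact Int.cast_eq_zero.mp h1
      simp only [T, T']
      rw [if_pos h, if_pos (hcond p h), hc, hW]
      rfl
    · have h' : ¬ (NonnegCuts B γ (rotDecomp p).1.1.2 ∧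
          (rotDecomp p).2 ∈ zeroCuts B γ (rotDecomp p).1.1.2) := by
        intro h1
        have := hcond _ h1
        rw [rotDecomp_involutive p] at this
        exact h this
      simp only [T, T']
      rw [if_neg h, if_neg h']
  have hsum : ∑ p, T' p = ∑ p, T p := by
    rw [← Equiv.sum_comp (rotDecomp_involutive (γ := γ)).toPerm T']
    exact Finset.sum_congr rfl fun p _ => hTT p
  have hcard : ∀ α : Decomp γ, ((zeroCuts B γ α.1.2).card : ℚ) ≠ 0 := by
    intro α
    have : (0 : Fin α.1.1) ∈ zeroCuts B γ α.1.2 := by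
      simp [zeroCuts, lowerSum_zero, pairing_zero]
    exact_mod_cast (Finset.card_pos.mpr ⟨_, this⟩).ne'
  have h1 : act Z.cutCol A γ = ∑ p, T' p := by
    rw [Fintype.sum_sigma]
    refine Finset.sum_congr rfl fun α _ => ?_
    simp only [T']
    by_cases h : NonnegCuts B γ α.1.2
    · simp only [h, true_and]
      rw [← Finset.sum_filter, Finset.filter_mem_eq_inter, Finset.univ_inter, Finset.sum_const,
        ← Nat.cast_smul_eq_nsmul ℚ, smul_smul, mul_div_cancel₀ _ (hcard α)]
    · simp only [h, false_and, if_false, Finset.sum_const_zero]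
      rw [cutCol_eq_zero B hθ _ _ α.2 h, zero_smul]
  -- For a fixed tuple the rotated weights add up to `(-1) ^ (n - 1)`; dividing by the number of
  -- zero cuts gives the value of g_*.
  have h2 : act (attractorCol B) A γ = ∑ p, T p := by
    rw [Fintype.sum_sigma]
    refine Finset.sum_congr rfl fun α _ => ?_
    simp only [T]
    rw [attractorCol_eq_ite B hB _ γ _ α.2]
    by_cases h : NonnegCuts B γ α.1.2
    · simp only [h, true_and, if_true]
      rw [← Finset.sum_filter, Finset.filter_mem_eq_inter, Finset.univ_inter, ← Finset.sum_smul,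
        ← Finset.sum_div, sum_cutCol_rot B hθ _ _ α.2 h]
    · simp only [h, false_and, if_false, Finset.sum_const_zero, zero_smul]
  rw [h1, h2, hsum]

/-! ### Existence of generic perturbations -/

/-- The linear form in `θ` that vanishes if and only if the `θ`-slopes of `a` and `b` agree. -/
def wallForm (a b : S r) : (Fin r → ℝ) →ₗ[ℝ] ℝ :=
  ∑ k, ((a.1 k : ℝ) * (degree b : ℝ) - (b.1 k : ℝ) * (degree a : ℝ)) • LinearMap.proj k

theorem wallForm_apply (a b : S r) (θ : Fin r → ℝ) :
    wallForm a b θ = ∑ k, ((a.1 k : ℝ) * degree b - (b.1 k : ℝ) * degree a) * θ k := by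
  simp [wallForm, LinearMap.sum_apply]

theorem slope_ofTheta (θ : Fin r → ℝ) (a : S r) :
    (CentralCharge.ofTheta θ).slope a = (∑ k, θ k * (a.1 k : ℝ)) / degree a := by
  simp [CentralCharge.slope, CentralCharge.ofTheta, degree]

theorem wallForm_eq_zero {a b : S r} {θ : Fin r → ℝ}
    (h : (CentralCharge.ofTheta θ).slope a = (CentralCharge.ofTheta θ).slope b) :
    wallForm a b θ = 0 := by
  have ha : (degree a : ℝ) ≠ 0 := by exact_mod_cast (degree_pos a).ne'
  have hb : (degree b : ℝ) ≠ 0 := by exact_mod_cast (degree_pos b).ne'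
  rw [slope_ofTheta, slope_ofTheta, div_eq_div_iff ha hb, Finset.sum_mul, Finset.sum_mul,
    ← sub_eq_zero, ← Finset.sum_sub_distrib] at h
  rw [wallForm_apply, ← h]
  exact Finset.sum_congr rfl fun k _ => by ring

theorem proportional_of_wallForm_eq_zero {a b : S r} (h : wallForm a b = 0) :
    ∃ m n : ℕ, 1 ≤ m ∧ 1 ≤ n ∧ m • a.1 = n • b.1 := by
  -- The coefficients of the form say that degree(b)·a = degree(a)·b; they are read off on unit
  -- vectors.
  refine ⟨degree b, degree a, degree_pos b, degree_pos a, ?_⟩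
  funext k
  have h1 := wallForm_apply a b (Pi.single k 1)
  rw [h, LinearMap.zero_apply] at h1
  simp only [Pi.single_apply, mul_ite, mul_one, mul_zero, Finset.sum_ite_eq', Finset.mem_univ,
    if_true] at h1
  have h2 : (a.1 k : ℝ) * degree b = (b.1 k : ℝ) * degree a := by linarith
  have h3 : a.1 k * degree b = b.1 k * degree a := by exact_mod_cast h2
  simp only [Pi.smul_apply, smul_eq_mul]
  rw [mul_comm, h3, mul_comm]

/-- Non-generic parameters lie on countably many proper hyperplanes, whose complements are open and
dense; apply Baire. -/
theorem dense_isGeneric : Dense {θ : Fin r → ℝ | (CentralCharge.ofTheta θ).IsGeneric} := by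
  let I := {p : S r × S r // wallForm p.1 p.2 ≠ 0}
  have h : Dense (⋂ i : I, ((LinearMap.ker (wallForm i.1.1 i.1.2) : Set (Fin r → ℝ))ᶜ)) := by
    refine dense_iInter_of_isOpen (fun i => ?_) fun i => ?_
    · exact (Submodule.closed_of_finiteDimensional _).isOpen_compl
    · rw [← interior_eq_empty_iff_dense_compl]
      by_contra hne
      have := Submodule.eq_top_of_nonempty_interior' _ (Set.nonempty_iff_ne_empty.mpr hne)
      exact i.2 (LinearMap.ker_eq_top.mp this)
  refine h.mono fun θ hθ a b hab => ?_
  by_contra hcon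
  have hne : wallForm a b ≠ 0 := fun h0 => hcon (proportional_of_wallForm_eq_zero h0)
  exact Set.mem_iInter.mp hθ ⟨(a, b), hne⟩ (wallForm_eq_zero hab)

theorem genericPerturbations_neBot (B : LinearMap.BilinForm ℤ (Fin r → ℤ)) (γ : S r) :
    (genericPerturbations B γ).NeBot :=
  mem_closure_iff_nhdsWithin_neBot.mp (dense_isGeneric _)

/-! ### The attractor invariants -/

theorem eventually_rationalDT_eq (B : LinearMap.BilinForm ℤ (Fin r → ℤ))
    (hB : ∀ a b, B a b = -B b a)
    {R : Type*} [Ring R] [Algebra ℚ R] (𝒜 : (Fin r → ℕ) → Submodule ℚ R) [GradedAlgebra 𝒜]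
    (hcomm : ∀ γ γ' : S r, B (toLattice γ.1) (toLattice γ'.1) = 0 →
      ∀ x ∈ 𝒜 γ.1, ∀ y ∈ 𝒜 γ'.1, x * y = y * x)
    (A : S r → R) (hA : ∀ γ, A γ ∈ 𝒜 γ.1) (γ : S r) :
    ∀ᶠ θ in genericPerturbations B γ,
      (CentralCharge.ofTheta θ).rationalDT A γ = act (attractorCol B) A γ := by
  filter_upwards [nhdsWithin_le_nhds (eventually_isPerturbation B hB γ)] with θ hθ
  rw [CentralCharge.rationalDT_eq_act]
  exact act_cutCol_eq_act_attractorCol B hB 𝒜 hcomm A hA hθ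

theorem attractorDT_eq (B : LinearMap.BilinForm ℤ (Fin r → ℤ))
    (hB : ∀ a b, B a b = -B b a)
    {R : Type*} [Ring R] [Algebra ℚ R] (𝒜 : (Fin r → ℕ) → Submodule ℚ R) [GradedAlgebra 𝒜]
    (hcomm : ∀ γ γ' : S r, B (toLattice γ.1) (toLattice γ'.1) = 0 →
      ∀ x ∈ 𝒜 γ.1, ∀ y ∈ 𝒜 γ'.1, x * y = y * x)
    (A : S r → R) (hA : ∀ γ, A γ ∈ 𝒜 γ.1) :
    attractorDT B A = act (attractorCol B) A := by
  funext γ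
  have h := eventually_rationalDT_eq B hB 𝒜 hcomm A hA γ
  have hex : ∃ x : R, ∀ᶠ θ in genericPerturbations B γ,
      (CentralCharge.ofTheta θ).rationalDT A γ = x := ⟨_, h⟩
  have := genericPerturbations_neBot B γ
  -- The filter is proper, so the chosen value and the computed one occur at a common `θ`.
  obtain ⟨θ, h1, h2⟩ := (h.and hex.choose_spec).exists
  rw [attractorDT, dif_pos hex, ← h1, h2]

end AttractorTree

theorem mainTheorem2 {r : ℕ} (B : LinearMap.BilinForm ℤ (Fin r → ℤ))
    (hB : ∀ a b, B a b = -B b a)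
    {R : Type*} [Ring R] [Algebra ℚ R] (𝒜 : (Fin r → ℕ) → Submodule ℚ R) [GradedAlgebra 𝒜]
    (hcomm : ∀ γ γ' : S r,
      B (toLattice γ.1) (toLattice γ'.1) = 0 →
        ∀ x ∈ 𝒜 γ.1, ∀ y ∈ 𝒜 γ'.1, x * y = y * x)
    (A : S r → R) (hA : ∀ γ, A γ ∈ 𝒜 γ.1) :
    -- the attractor invariants are well defined
    (∀ γ, (genericPerturbations B γ).NeBot ∧
      ∀ᶠ θ' in genericPerturbations B γ,
        (CentralCharge.ofTheta θ').rationalDT A γ =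
          attractorDT B A γ) ∧
    IsPlethInv (attractorCol B)
      (plethInv (attractorCol B)) ∧
    ∀ Z : CentralCharge r,
      IsPlethInv Z.hn (plethInv Z.hn) ∧
      -- the attractor tree formula
      Z.rationalDT A = act (treeCol B Z)
        (attractorDT B A) ∧
      treeCol B Z =
        idCol r + pleth (Z.g - attractorCol B)
          (freeCol (idCol r - attractorCol B)) ∧
      treeCol B Z =
        pleth Z.g (plethInv (attractorCol B)) := by
  have hinv := isPlethInv_plethInv _ (attractorCol_one B)
  have hDT := attractorDT_eq B hB 𝒜 hcomm A hA
  refine ⟨fun γ => ⟨genericPerturbations_neBot B γ, ?_⟩, hinv, fun Z => ?_⟩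
  · rw [hDT]
    exact eventually_rationalDT_eq B hB 𝒜 hcomm A hA γ
  · have htree := treeCol_eq_pleth B Z Z.g_one (attractorCol_one B)
    refine ⟨isPlethInv_plethInv _ Z.hn_one, ?_,
      treeCol_eq_add_pleth B Z Z.g_one (attractorCol_one B), htree⟩
    -- The right side is (g_Z ∘ g_*⁻¹ ∘ g_*) * A = g_Z * A.
    rw [htree, hDT, ← act_pleth, pleth_assoc, hinv.2, pleth_idCol, Z.g_eq_cutCol,
      Z.rationalDT_eq_act]
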